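/- **Theorem 48.1.** Let $X$ be a topological space and let $\varphi$ be a family of supports on $X$: a collection of closed subsets of $X$ that contains $\emptyset$ and is stable under passing to closed subsets and under finite unions. All sheaves are sheaves of abelian groups on $X$. For a sheaf $\mathcal B$, let $\Gamma_\varphi(\mathcal B)$ be the group of global sections $s$ of $\mathcal B$ whose support $|s|=\{x\in X: s(x)\neq 0\}$ belongs to $\varphi$. *Cohomology with supports.* Let $\mathcal Y^0(X;\mathcal B)$ be the sheaf $U\mapsto\prod_{x\in U}\mathcal B_x$, let $\varepsilon:\mathcal B\to\mathcal Y^0(X;\mathcal B)$ be the natural monomorphism, and let $\mathcal Z^1(X;\mathcal B)$ be its cokernel. Put $\mathcal Z^0(X;\mathcal B)=\mathcal B$, $\mathcal Z^{m+1}(X;\mathcal B)=\mathcal Z^1(X;\mathcal Z^m(X;\mathcal B))$ and $\mathcal Y^m(X;\mathcal B)=\mathcal Y^0(X;\mathcal Z^m(X;\mathcal B))$. With the differentials $\mathcal Y^m\to\mathcal Z^{m+1}\to\mathcal Y^{m+1}$ this is a complex $\mathcal Y^*(X;\mathcal B)$, functorial in $\mathcal B$, and $H^m_\varphi(X;\mathcal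 B):=H^m(\Gamma_\varphi(\mathcal Y^*(X;\mathcal B)))$. A sheaf $\mathcal B$ is called $\varphi$-acyclic if $H^m_\varphi(X;\mathcal B)=0$ for all $m>0$. A short exact sequence of sheaves $0\to\mathcal B_1\to\mathcal B_2\to\mathcal B_3\to0$ has connecting homomorphisms $H^m_\varphi(X;\mathcal B_3)\to H^{m+1}_\varphi(X;\mathcal B_1)$, namely those of the short exact sequence of complexes $0\to\Gamma_\varphi(\mathcal Y^*(X;\mathcal B_1))\to\Gamma_\varphi(\mathcal Y^*(X;\mathcal B_2))\to\Gamma_\varphi(\mathcal Y^*(X;\mathcal B_3))\to0$. *Resolvents and $\kappa$.* A resolvent of $\mathcal B$ is a complex of sheaves $\mathcal L^*$ in degrees $\geq0$ with a homomorphism $\mathcal B\to\mathcal L^0$ such that $0\to\mathcal B\to\mathcal L^0\to\mathcal L^1\to\cdots$ is exact. Put $\mathcal Z^0=\mathcal B$ and $\mathcal Z^j=\ker(\mathcal L^j\to\mathcal L^{j+1})$ for $j>0$. For $b\geq0$ the homomorphism $$\kappa: H^b(\Gamma_\varphi(\mathcal L^*))\to H^b_\varphi(X;\mathcal B)$$ is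 defined as follows. Represent $u\in H^b(\Gamma_\varphi(\mathcal L^*))$ by a section in $\Gamma_\varphi(\mathcal Z^b)=H^0_\varphi(X;\mathcal Z^b)$ and apply successively the connecting homomorphisms $$H^0_\varphi(X;\mathcal Z^b)\to H^1_\varphi(X;\mathcal Z^{b-1})\to\cdots\to H^b_\varphi(X;\mathcal Z^0)=H^b_\varphi(X;\mathcal B)$$ of the short exact sequences $0\to\mathcal Z^j\to\mathcal L^j\to\mathcal Z^{j+1}\to0$. *Claim.* For every $b\geq0$: 1. For every resolvent, $\kappa$ is a well-defined homomorphism. It is natural: if $\mathcal L^*$ and $\mathcal M^*$ are resolvents of $\mathcal B$ and $\mathcal E$, and $f:\mathcal B\to\mathcal E$, $g:\mathcal L^*\to\mathcal M^*$ are homomorphisms compatible with the augmentations, then $\kappa\circ g_*=f_*\circ\kappa$. 2. If all sheaves $\mathcal L^m$, $m\geq0$, are $\varphi$-acyclic, then $\kappa: H^b(\Gamma_\varphi(\mathcal L^*))\to H^b_\varphi(X;\mathcal B)$ is an isomorphism. 3. This includes twisted sheaves. Call $\mathcal F$ twisted over the standard generators $i_0,\dots,i_{2^r-1}$ of the Cayley–Dickson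 algebra $\mathcal A_r$ if it is given as a direct sum $\mathcal F=\mathcal F_0i_0\oplus\cdots\oplus\mathcal F_{2^r-1}i_{2^r-1}$ of sheaves of abelian groups $\mathcal F_k$ that are pairwise isomorphic. If $\mathcal B$ and all $\mathcal L^m$ are twisted over $i_0,\dots,i_{2^r-1}$, the augmentation and the differentials map $k$-th components to $k$-th components, and all $\mathcal L^m$ are $\varphi$-acyclic, then for each $k$ the isomorphism $\kappa$ maps the $k$-th component of $H^b(\Gamma_\varphi(\mathcal L^*))$ (the classes of cocycles in $\Gamma_\varphi(\mathcal L^b_k)$) onto the $k$-th component of $H^b_\varphi(X;\mathcal B)$ (the image of $H^b_\varphi(X;\mathcal B_k)$). -/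

import Mathlib

open CategoryTheory CategoryTheory.Limits TopologicalSpace Opposite

universe u

noncomputable section

namespace SupportCohomology

/-- A family of supports on `X`: a collection of closed subsets of `X`, stable under passing to
closed subsets and under finite unions (the empty union included). -/
structure SupportFamily (X : TopCat.{u}) where
  /-- the members of the family -/
  sets : Set (Set X)
  isClosed_of_mem : ∀ C ∈ sets, IsClosed C
  mem_of_subset : ∀ C ∈ sets, ∀ B : Set X, IsClosed B → B ⊆ C → B ∈ sets
  empty_mem : ∅ ∈ sets
  union_mem : ∀ B ∈ sets, ∀ C ∈ sets, B ∪ C ∈ sets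

/-- Sheaves of abelian groups on `X`. -/
abbrev AbSheaf (X : TopCat.{u}) := TopCat.Sheaf AddCommGrpCat.{u} X

variable {X : TopCat.{u}}

/-! ### Sections with supports -/

/-- The support `|s| = {x : s(x) ≠ 0}` of a global section `s`, where `s(x)` is the germ. -/
def support (F : AbSheaf X) (s : F.presheaf.obj (op ⊤)) : Set X :=
  {x | F.presheaf.germ ⊤ x (Opens.mem_top x) s ≠ 0}

lemma isClosed_support (F : AbSheaf X) (s : F.presheaf.obj (op ⊤)) :
    IsClosed (support F s) := by
  rw [← isOpen_compl_iff, isOpen_iff_forall_mem_open]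
  intro x hx
  have hx' : F.presheaf.germ ⊤ x (Opens.mem_top x) s = 0 := by
    simpa [support] using hx
  obtain ⟨W, hxW, i, j, h⟩ := F.presheaf.germ_eq (C := AddCommGrpCat.{u}) x
    (Opens.mem_top x) (Opens.mem_top x) s 0
    (by rw [hx', map_zero])
  refine ⟨W, fun y hy => ?_, W.2, hxW⟩
  have h1 : F.presheaf.germ ⊤ y (Opens.mem_top y) s = 0 := by
    rw [← F.presheaf.germ_res_apply i y hy, h, map_zero, map_zero]
  simpa [support] using h1

lemma support_zero (F : AbSheaf X) : support F 0 = ∅ := by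
  ext x; simp [support]

lemma support_add (F : AbSheaf X) (s t : F.presheaf.obj (op ⊤)) :
    support F (s + t) ⊆ support F s ∪ support F t := by
  intro x hx
  by_contra h
  simp only [support, Set.mem_union, Set.mem_ofPred_eq, not_or, not_not] at h hx
  exact hx (by rw [map_add, h.1, h.2, add_zero])

lemma support_neg (F : AbSheaf X) (s : F.presheaf.obj (op ⊤)) :
    support F (-s) = support F s := by
  ext x; simp [support]

lemma support_map {F G : AbSheaf X} (f : F ⟶ G) (s : F.presheaf.obj (op ⊤)) :
    support G (f.hom.app (op ⊤) s) ⊆ support F s := by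
  intro x hx
  by_contra h
  simp only [support, Set.mem_ofPred_eq, not_not] at h hx
  apply hx
  rw [← TopCat.Presheaf.stalkFunctor_map_germ_apply, h]
  exact map_zero _

/-- `Γ_φ(F)`: the group of global sections of `F` with support in `φ`. -/
def sectionsWithSupport (φ : SupportFamily X) (F : AbSheaf X) :
    AddSubgroup (F.presheaf.obj (op ⊤)) where
  carrier := {s | support F s ∈ φ.sets}
  zero_mem' := by
    rw [Set.mem_ofPred_eq, support_zero]
    exact φ.empty_mem
  add_mem' {s t} hs ht := φ.mem_of_subset _ (φ.union_mem _ hs _ ht) _ (isClosed_support F _)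
    (support_add F s t)
  neg_mem' {s} hs := by
    rw [Set.mem_ofPred_eq, support_neg]
    exact hs

/-- The functor `F ↦ Γ_φ(F)`. -/
def Gam (φ : SupportFamily X) : AbSheaf X ⥤ AddCommGrpCat.{u} where
  obj F := AddCommGrpCat.of (sectionsWithSupport φ F)
  map {F G} f := AddCommGrpCat.ofHom
    { toFun := fun s => ⟨f.hom.app (op ⊤) s.1,
        φ.mem_of_subset _ s.2 _ (isClosed_support G _) (support_map f s.1)⟩
      map_zero' := Subtype.ext (map_zero _)
      map_add' := fun s t => Subtype.ext (map_add _ _ _) }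
  map_id F := by ext s; rfl
  map_comp f g := by ext s; rfl

instance (φ : SupportFamily X) : (Gam φ).Additive where
  map_add {F G f g} := by ext s; rfl

/-- The cochain complex `Γ_φ(L^*)` attached to a complex of sheaves `L^*`. -/
abbrev GamComplex (φ : SupportFamily X) (L : CochainComplex (AbSheaf X) ℕ) :
    CochainComplex AddCommGrpCat.{u} ℕ :=
  ((Gam φ).mapHomologicalComplex _).obj L

/-- The map of cochain complexes `Γ_φ(L^*) ⟶ Γ_φ(M^*)` induced by `L^* ⟶ M^*`. -/
abbrev GamComplexMap (φ : SupportFamily X) {L M : CochainComplex (AbSheaf X) ℕ} (g : L ⟶ M) :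
    GamComplex φ L ⟶ GamComplex φ M :=
  ((Gam φ).mapHomologicalComplex _).map g

/-- `c` is the cohomology class of the cocycle `x`: that is, `x ∈ K^m` is a cocycle whose class in
`H^m(K)` is `c`. -/
def IsClassOf (K : CochainComplex AddCommGrpCat.{u} ℕ) (m : ℕ) (x : K.X m) (c : K.homology m) :
    Prop :=
  ∃ z : K.cycles m, K.iCycles m z = x ∧ K.homologyπ m z = c

/-! ### The canonical resolvent -/

/-- The presheaf `U ↦ ∏_{x ∈ U} B_x` of all, possibly discontinuous, sections of `B`. -/
def discPresheaf (B : AbSheaf X) : X.Presheaf AddCommGrpCat.{u} where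
  obj U := AddCommGrpCat.of (∀ x : U.unop, B.presheaf.stalk x.1)
  map {U V} i := AddCommGrpCat.ofHom
    { toFun := fun f x => f ⟨x.1, i.unop.le x.2⟩
      map_zero' := rfl
      map_add' := fun _ _ => rfl }
  map_id U := by ext f; rfl
  map_comp i j := by ext f; rfl

lemma discPresheaf_isSheaf (B : AbSheaf X) : (discPresheaf B).IsSheaf := by
  rw [TopCat.Presheaf.isSheaf_iff_isSheaf_comp (forget AddCommGrpCat.{u})]
  exact TopCat.Presheaf.toTypes_isSheaf X (fun x => (B.presheaf.stalk x : Type u))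

/-- `𝒴⁰(X; B)`, the sheaf `U ↦ ∏_{x ∈ U} B_x`. -/
def Y0 (B : AbSheaf X) : AbSheaf X := ⟨discPresheaf B, discPresheaf_isSheaf B⟩

/-- The map `𝒴⁰(X; B) ⟶ 𝒴⁰(X; E)` induced by `f : B ⟶ E`. -/
def Y0Map {B E : AbSheaf X} (f : B ⟶ E) : Y0 B ⟶ Y0 E := ⟨
  { app := fun U => AddCommGrpCat.ofHom
      { toFun := fun s x => (TopCat.Presheaf.stalkFunctor AddCommGrpCat.{u} x.1).map f.hom (s x)
        map_zero' := funext fun _ => map_zero _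
        map_add' := fun _ _ => funext fun _ => map_add _ _ _ }
    naturality := fun U V i => by ext s; rfl }⟩

/-- The augmentation `B ⟶ 𝒴⁰(X; B)`, which regards a (continuous) section as a family of germs. -/
def aug (B : AbSheaf X) : B ⟶ Y0 B := ⟨
  { app := fun U => AddCommGrpCat.ofHom
      { toFun := fun s x => B.presheaf.germ U.unop x.1 x.2 s
        map_zero' := funext fun _ => map_zero _
        map_add' := fun _ _ => funext fun _ => map_add _ _ _ }
    naturality := fun U V i => by
      ext s
      funext x
      exact TopCat.Presheaf.germ_res_apply' B.presheaf i x.1 x.2 s }⟩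

lemma aug_naturality {B E : AbSheaf X} (f : B ⟶ E) : f ≫ aug E = aug B ≫ Y0Map f := by
  apply CategoryTheory.Sheaf.hom_ext
  ext U s
  funext x
  exact (TopCat.Presheaf.stalkFunctor_map_germ_apply U.unop x.1 x.2 f.hom s).symm

/-- `𝒵¹(X; B)`, the cokernel of the augmentation `B ⟶ 𝒴⁰(X; B)`. -/
def Z1 (B : AbSheaf X) : AbSheaf X := cokernel (aug B)

/-- The projection `∂ : 𝒴⁰(X; B) ⟶ 𝒵¹(X; B)`. -/
def bdry (B : AbSheaf X) : Y0 B ⟶ Z1 B := cokernel.π (aug B)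

lemma aug_bdry (B : AbSheaf X) : aug B ≫ bdry B = 0 := cokernel.condition _

/-- The map `𝒵¹(X; B) ⟶ 𝒵¹(X; E)` induced by `f : B ⟶ E`. -/
def Z1Map {B E : AbSheaf X} (f : B ⟶ E) : Z1 B ⟶ Z1 E :=
  cokernel.map _ _ f (Y0Map f) (aug_naturality f).symm

lemma bdry_naturality {B E : AbSheaf X} (f : B ⟶ E) : bdry B ≫ Z1Map f = Y0Map f ≫ bdry E :=
  cokernel.π_desc _ _ _

/-- `𝒵^m(X; B)`: `𝒵^0 = B` and `𝒵^{m+1} = 𝒵¹(X; 𝒵^m)`. -/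
def Zm (B : AbSheaf X) : ℕ → AbSheaf X
  | 0 => B
  | m + 1 => Z1 (Zm B m)

/-- The map `𝒵^m(X; B) ⟶ 𝒵^m(X; E)` induced by `f : B ⟶ E`. -/
def ZmMap {B E : AbSheaf X} (f : B ⟶ E) : ∀ m : ℕ, Zm B m ⟶ Zm E m
  | 0 => f
  | m + 1 => Z1Map (ZmMap f m)

/-- `𝒴^m(X; B) = 𝒴⁰(X; 𝒵^m(X; B))`. -/
def Ym (B : AbSheaf X) (m : ℕ) : AbSheaf X := Y0 (Zm B m)

/-- The projection `∂ : 𝒴^m(X; B) ⟶ 𝒵^{m+1}(X; B)`. -/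
def Ybdry (B : AbSheaf X) (m : ℕ) : Ym B m ⟶ Zm B (m + 1) := bdry (Zm B m)

/-- The augmentation `𝒵^m(X; B) ⟶ 𝒴^m(X; B)`. -/
def Yaug (B : AbSheaf X) (m : ℕ) : Zm B m ⟶ Ym B m := aug (Zm B m)

lemma Yaug_bdry (B : AbSheaf X) (m : ℕ) : Yaug B m ≫ Ybdry B m = 0 := aug_bdry _

/-- The differential `𝒴^m ⟶ 𝒵^{m+1} ⟶ 𝒴^{m+1}`. -/
def Yd (B : AbSheaf X) (m : ℕ) : Ym B m ⟶ Ym B (m + 1) := Ybdry B m ≫ Yaug B (m + 1)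

lemma Yd_comp (B : AbSheaf X) (m : ℕ) : Yd B m ≫ Yd B (m + 1) = 0 := by
  rw [Yd, Yd, Category.assoc, ← Category.assoc (Yaug B (m + 1)), Yaug_bdry, zero_comp, comp_zero]

/-- The map `𝒴^m(X; B) ⟶ 𝒴^m(X; E)` induced by `f : B ⟶ E`. -/
def YmMap {B E : AbSheaf X} (f : B ⟶ E) (m : ℕ) : Ym B m ⟶ Ym E m := Y0Map (ZmMap f m)

lemma YmMap_d {B E : AbSheaf X} (f : B ⟶ E) (m : ℕ) :
    YmMap f m ≫ Yd E m = Yd B m ≫ YmMap f (m + 1) := by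
  have h1 : YmMap f m ≫ Ybdry E m = Ybdry B m ≫ ZmMap f (m + 1) := (bdry_naturality _).symm
  have h2 : ZmMap f (m + 1) ≫ Yaug E (m + 1) = Yaug B (m + 1) ≫ YmMap f (m + 1) :=
    aug_naturality _
  rw [Yd, Yd, ← Category.assoc, h1, Category.assoc, h2, Category.assoc]

/-- The canonical resolvent `𝒴^*(X; B)`. -/
def Y (B : AbSheaf X) : CochainComplex (AbSheaf X) ℕ :=
  CochainComplex.of (Ym B) (Yd B) (Yd_comp B)

/-- The map `𝒴^*(X; B) ⟶ 𝒴^*(X; E)` induced by `f : B ⟶ E`. -/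
def YMap {B E : AbSheaf X} (f : B ⟶ E) : Y B ⟶ Y E :=
  CochainComplex.ofHom (YmMap f) (fun m => by
    have h1 : (Y E).d m (m + 1) = Yd E m := CochainComplex.of_d _ _ _
    have h2 : (Y B).d m (m + 1) = Yd B m := CochainComplex.of_d _ _ _
    rw [h1, h2]
    exact YmMap_d f m)

/-- The complex `Y^*_φ(X; B) = Γ_φ(𝒴^*(X; B))`. -/
abbrev Yphi (φ : SupportFamily X) (B : AbSheaf X) : CochainComplex AddCommGrpCat.{u} ℕ :=
  GamComplex φ (Y B)

/-- The map `Y^*_φ(X; B) ⟶ Y^*_φ(X; E)` induced by `B ⟶ E`. -/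
abbrev YphiMap (φ : SupportFamily X) {B E : AbSheaf X} (f : B ⟶ E) : Yphi φ B ⟶ Yphi φ E :=
  GamComplexMap φ (YMap f)

/-- `H^m_φ(X; B)`, the cohomology of `X` with supports in `φ` and coefficients in `B`. -/
abbrev H (φ : SupportFamily X) (m : ℕ) (B : AbSheaf X) : AddCommGrpCat.{u} :=
  (Yphi φ B).homology m

/-- The map `f_* : H^m_φ(X; B) ⟶ H^m_φ(X; E)` induced by `f : B ⟶ E`. -/
abbrev HMap (φ : SupportFamily X) (m : ℕ) {B E : AbSheaf X} (f : B ⟶ E) :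
    H φ m B ⟶ H φ m E :=
  HomologicalComplex.homologyMap (YphiMap φ f) m

/-- A sheaf `B` is `φ`-acyclic if `H^b_φ(X; B) = 0` for all `b > 0`. -/
def IsAcyclic (φ : SupportFamily X) (B : AbSheaf X) : Prop :=
  ∀ b : ℕ, 0 < b → ∀ c : H φ b B, c = 0

/-! ### Resolvents and the map `κ` -/

/-- A sheaf `B` together with a resolvent `L^*` of it: an augmented complex of sheaves
`0 ⟶ B ⟶ L^0 ⟶ L^1 ⟶ ⋯` which is exact. -/
structure Resolvent (X : TopCat.{u}) where
  /-- the sheaf that is resolved -/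
  B : AbSheaf X
  /-- the differential sheaf -/
  L : CochainComplex (AbSheaf X) ℕ
  /-- the augmentation -/
  ε : B ⟶ L.X 0
  ε_d : ε ≫ L.d 0 1 = 0
  mono_ε : Mono ε
  exact_zero : (ShortComplex.mk ε (L.d 0 1) ε_d).Exact
  exact_succ : ∀ m : ℕ, (L.sc' m (m + 1) (m + 2)).Exact

/-- A homomorphism `(f, g)` of resolvents: `f : B ⟶ E` and `g : L^* ⟶ M^*` that commute with the
augmentations. -/
structure ResolventHom (R S : Resolvent X) where
  /-- the map of the resolved sheaves -/
  f : R.B ⟶ S.B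
  /-- the map of the differential sheaves -/
  g : R.L ⟶ S.L
  comm : R.ε ≫ g.f 0 = f ≫ S.ε

namespace Resolvent

variable (R : Resolvent X)

/-- `𝒵^j = Ker (L^j ⟶ L^{j+1})` for `j > 0`, and `𝒵^0 = B`. -/
def Z : ℕ → AbSheaf X
  | 0 => R.B
  | j + 1 => R.L.cycles (j + 1)

/-- The monomorphism `𝒵^j ⟶ L^j` (the augmentation for `j = 0`). -/
def ι : ∀ j : ℕ, R.Z j ⟶ R.L.X j
  | 0 => R.ε
  | j + 1 => R.L.iCycles (j + 1)

/-- The epimorphism `L^j ⟶ 𝒵^{j+1}` induced by the differential. -/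
def p (j : ℕ) : R.L.X j ⟶ R.Z (j + 1) := R.L.toCycles j (j + 1)

end Resolvent

/-- The graph of the connecting homomorphism `δ : H^m_φ(X; C) → H^{m+1}_φ(X; A)` of a short exact
sequence `0 ⟶ A ⟶ B ⟶ C ⟶ 0` of sheaves, i.e. of the connecting homomorphism of the short exact
sequence of complexes `Y^*_φ(X; A) ⟶ Y^*_φ(X; B) ⟶ Y^*_φ(X; C)`: one has `δ c = a` when there is a
cochain `y ∈ Y^m_φ(X; B)` mapping to a cocycle of class `c`, and whose coboundary is the image of a
cocycle of class `a`. -/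
def IsConnecting (φ : SupportFamily X) {A B C : AbSheaf X} (i : A ⟶ B) (p : B ⟶ C) (m : ℕ)
    (c : H φ m C) (a : H φ (m + 1) A) : Prop :=
  ∃ (y : (Yphi φ B).X m) (x : (Yphi φ A).X (m + 1)),
    IsClassOf (Yphi φ C) m ((YphiMap φ p).f m y) c ∧
    IsClassOf (Yphi φ A) (m + 1) x a ∧
    (YphiMap φ i).f (m + 1) x = (Yphi φ B).d m (m + 1) y

/-- The identification `Γ_φ(B) ≅ H^0_φ(X; B)` on the level of cochains: a section `s` is sent to
the cochain `ε(s) ∈ Y^0_φ(X; B)`. -/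
def augSection (φ : SupportFamily X) (B : AbSheaf X) (s : (Gam φ).obj B) : (Yphi φ B).X 0 :=
  (Gam φ).map (aug B) s

/-- The successive images of a class `u ∈ H^b(Γ_φ(L^*))` under
`H^b(Γ_φ(L^*)) → H^1_φ(X; 𝒵^{b-1}) → H^2_φ(X; 𝒵^{b-2}) → ⋯ → H^b_φ(X; 𝒵^0)`:
`KappaGraph φ R b u v j w` says that `w ∈ H^v_φ(X; 𝒵^j)`, `j = b - v`, is such an image of `u`.
One starts from a representative of `u` by a section `s` of `𝒵^b`, viewed as an element of
`H^0_φ(X; 𝒵^b)`, and applies `v` times the connecting homomorphisms of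
`0 ⟶ 𝒵^j ⟶ L^j ⟶ 𝒵^{j+1} ⟶ 0`. -/
inductive KappaGraph (φ : SupportFamily X) (R : Resolvent X) (b : ℕ)
    (u : (GamComplex φ R.L).homology b) : ∀ v j : ℕ, H φ v (R.Z j) → Prop
  | start (s : (Gam φ).obj (R.Z b)) (w : H φ 0 (R.Z b))
      (hu : IsClassOf (GamComplex φ R.L) b ((Gam φ).map (R.ι b) s) u)
      (hw : IsClassOf (Yphi φ (R.Z b)) 0 (augSection φ (R.Z b) s) w) :
      KappaGraph φ R b u 0 b w
  | step (v j : ℕ) (w : H φ v (R.Z (j + 1))) (w' : H φ (v + 1) (R.Z j))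
      (h : KappaGraph φ R b u v (j + 1) w)
      (hδ : IsConnecting φ (R.ι j) (R.p j) v w w') :
      KappaGraph φ R b u (v + 1) j w'

/-- The homomorphism `κ : H^b(Γ_φ(L^*)) → H^b_φ(X; B)` is the composition
`H^b(Γ_φ(L^*)) → H^1_φ(X; 𝒵^{b-1}) → ⋯ → H^b_φ(X; 𝒵^0)`. -/
def IsKappa (φ : SupportFamily X) (R : Resolvent X) (b : ℕ)
    (κ : (GamComplex φ R.L).homology b →+ H φ b R.B) : Prop :=
  ∀ (u : (GamComplex φ R.L).homology b) (w : H φ b R.B),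
    κ u = w ↔ KappaGraph φ R b u b 0 w

/-! ### Twisted sheaves -/

/-- A twisted structure on a sheaf `F` over the standard generators `i_0, …, i_{2^r-1}` of the
Cayley-Dickson algebra `𝒜_r`: a decomposition `F = F_0 i_0 ⊕ ⋯ ⊕ F_{2^r-1} i_{2^r-1}` with
pairwise isomorphic commutative components. `incl k` is the inclusion of the summand `F_k i_k`. -/
structure TwistedStructure (r : ℕ) (F : AbSheaf X) where
  /-- the components `F_k` -/
  comp : Fin (2 ^ r) → AbSheaf X
  /-- the inclusions of `F_k i_k` into `F` -/
  incl : ∀ k, comp k ⟶ F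
  isSum : Nonempty (IsColimit (Cofan.mk F incl))
  comp_iso : ∀ j k, Nonempty (comp j ≅ comp k)

/-- A homomorphism of sheaves maps the `k`-th component to the `k`-th component, for every `k`. -/
def TwistedStructure.Preserves {r : ℕ} {F G : AbSheaf X} (S : TwistedStructure r F)
    (T : TwistedStructure r G) (f : F ⟶ G) : Prop :=
  ∀ k, ∃ fk : S.comp k ⟶ T.comp k, S.incl k ≫ f = fk ≫ T.incl k

/-- A twisted structure on a resolvent: twisted structures on `B` and on all `L^m` that are
respected by the augmentation and by the differentials. -/
structure TwistedResolvent (r : ℕ) (R : Resolvent X) where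
  /-- the twisted structure of `B` -/
  onB : TwistedStructure r R.B
  /-- the twisted structures of the `L^m` -/
  onL : ∀ m, TwistedStructure r (R.L.X m)
  preserves_ε : onB.Preserves (onL 0) R.ε
  preserves_d : ∀ m, (onL m).Preserves (onL (m + 1)) (R.L.d m (m + 1))

/-- The `k`-th component of `H^b(Γ_φ(L^*))`: the classes of the cocycles that lie in the `k`-th
component of `Γ_φ(L^b)`. -/
def TwistedResolvent.sourceComponent {r : ℕ} {R : Resolvent X} (T : TwistedResolvent r R)
    (φ : SupportFamily X) (b : ℕ) (k : Fin (2 ^ r)) : Set ((GamComplex φ R.L).homology b) :=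
  {u | ∃ x : (Gam φ).obj ((T.onL b).comp k),
    IsClassOf (GamComplex φ R.L) b ((Gam φ).map ((T.onL b).incl k) x) u}

/-- The `k`-th component of `H^b_φ(X; B)`: the image of `H^b_φ(X; B_k)`. -/
def TwistedResolvent.targetComponent {r : ℕ} {R : Resolvent X} (T : TwistedResolvent r R)
    (φ : SupportFamily X) (b : ℕ) (k : Fin (2 ^ r)) : Set (H φ b R.B) :=
  Set.range (HMap φ b (T.onB.incl k))

end SupportCohomology

end

open CategoryTheory CategoryTheory.Limits TopologicalSpace Opposite

noncomputable section

namespace SupportCohomology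

/-! ### Cohomology classes of cocycles -/

section Complexes

variable {K L : CochainComplex AddCommGrpCat.{u} ℕ} {m : ℕ}

/-! Everything rests on the long exact cohomology sequence with supports, argued on cocycles. The
functor `Γ_φ(𝒴^*(-))` takes a short exact sequence of sheaves to a degreewise short exact sequence
of complexes (`degreewiseExact_YphiMap`): each `𝒵^m` preserves short exact sequences by the snake
lemma, and a family of germs can be lifted point by point, with zero lifted to zero so that the
support does not grow (`Gam_Y0Map_surjective`). Left exactness of `Γ_φ` identifies `Γ_φ(B)` with
`H^0_φ(X; B)`.

For `b > 0`, two sections of `𝒵^b` representing the same class differ by the image of a section of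
`L^{b-1}`. That difference dies under the first connecting homomorphism, and every connecting
homomorphism is single-valued, so the relation `KappaGraph` is the graph of a homomorphism
(`KappaGraph.eq_zero`). If the `L^m` are acyclic, the kernel of the first connecting homomorphism is
exactly the image of `Γ_φ(L^{b-1})`, the later ones are injective, and all are surjective; hence
`kappa_bijective`. Naturality is inherited from that of the connecting homomorphisms
(`ResolventHom.kappaGraph_map`).

In the twisted case the `k`-th components form a direct summand of the resolvent, hence an acyclic
resolvent of `B_k`. Naturality for its inclusion, together with surjectivity of its own `κ`,
identifies the components. -/

lemma exists_isClassOf (c : K.homology m) : ∃ x, IsClassOf K m x c := by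
  obtain ⟨z, hz⟩ := (AddCommGrpCat.epi_iff_surjective (K.homologyπ m)).1 inferInstance c
  exact ⟨K.iCycles m z, z, rfl, hz⟩

lemma IsClassOf.d_eq_zero {x : K.X m} {c : K.homology m} (h : IsClassOf K m x c) (n : ℕ) :
    K.d m n x = 0 := by
  obtain ⟨z, rfl, -⟩ := h
  rw [← ConcreteCategory.comp_apply, K.iCycles_d]
  rfl

lemma iCycles_injective : Function.Injective (K.iCycles m) :=
  (AddCommGrpCat.mono_iff_injective _).1 inferInstance

lemma exists_cycles_of_d_eq_zero {x : K.X m} (h : K.d m (m + 1) x = 0) :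
    ∃ z : K.cycles m, K.iCycles m z = x := by
  have hex : (ShortComplex.mk (K.iCycles m) (K.d m (m + 1)) (K.iCycles_d m (m + 1))).Exact :=
    ShortComplex.exact_of_f_is_kernel _ (K.cyclesIsKernel m (m + 1) (by simp))
  exact (ShortComplex.ab_exact_iff _).1 hex x h

lemma exists_class_of_d_eq_zero {x : K.X m} (h : K.d m (m + 1) x = 0) :
    ∃ c, IsClassOf K m x c := by
  obtain ⟨z, hz⟩ := exists_cycles_of_d_eq_zero h
  exact ⟨_, z, hz, rfl⟩

lemma IsClassOf.unique {x : K.X m} {c c' : K.homology m} (h : IsClassOf K m x c)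
    (h' : IsClassOf K m x c') : c = c' := by
  obtain ⟨z, hz, rfl⟩ := h
  obtain ⟨z', hz', rfl⟩ := h'
  rw [iCycles_injective (hz.trans hz'.symm)]

lemma isClassOf_zero : IsClassOf K m 0 0 := ⟨0, map_zero _, map_zero _⟩

lemma IsClassOf.add {x y : K.X m} {c c' : K.homology m} (h : IsClassOf K m x c)
    (h' : IsClassOf K m y c') : IsClassOf K m (x + y) (c + c') := by
  obtain ⟨z, rfl, rfl⟩ := h
  obtain ⟨z', rfl, rfl⟩ := h'
  exact ⟨z + z', map_add _ _ _, map_add _ _ _⟩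

lemma IsClassOf.sub {x y : K.X m} {c c' : K.homology m} (h : IsClassOf K m x c)
    (h' : IsClassOf K m y c') : IsClassOf K m (x - y) (c - c') := by
  obtain ⟨z, rfl, rfl⟩ := h
  obtain ⟨z', rfl, rfl⟩ := h'
  exact ⟨z - z', map_sub _ _ _, map_sub _ _ _⟩

lemma IsClassOf.map {x : K.X m} {c : K.homology m} (h : IsClassOf K m x c) (f : K ⟶ L) :
    IsClassOf L m (f.f m x) (HomologicalComplex.homologyMap f m c) := by
  obtain ⟨z, rfl, rfl⟩ := h
  refine ⟨HomologicalComplex.cyclesMap f m z, ?_, ?_⟩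
  · rw [← ConcreteCategory.comp_apply, HomologicalComplex.cyclesMap_i,
      ConcreteCategory.comp_apply]
  · rw [← ConcreteCategory.comp_apply, ← HomologicalComplex.homologyπ_naturality,
      ConcreteCategory.comp_apply]

lemma isClassOf_d (y : K.X m) : IsClassOf K (m + 1) (K.d m (m + 1) y) 0 := by
  refine ⟨K.toCycles m (m + 1) y, ?_, ?_⟩
  · rw [← ConcreteCategory.comp_apply, K.toCycles_i]
  · rw [← ConcreteCategory.comp_apply, K.toCycles_comp_homologyπ]
    rfl

lemma IsClassOf.exists_d_eq {x : K.X (m + 1)} (h : IsClassOf K (m + 1) x 0) :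
    ∃ y, K.d m (m + 1) y = x := by
  obtain ⟨z, rfl, hz⟩ := h
  have hex : (ShortComplex.mk (K.toCycles m (m + 1)) (K.homologyπ (m + 1))
      (K.toCycles_comp_homologyπ m (m + 1))).Exact :=
    ShortComplex.exact_of_g_is_cokernel _ (K.homologyIsCokernel m (m + 1) (by simp))
  obtain ⟨y, hy⟩ := (ShortComplex.ab_exact_iff _).1 hex z hz
  refine ⟨y, ?_⟩
  rw [← hy, ← K.toCycles_i m (m + 1)]
  exact ConcreteCategory.comp_apply _ _ _

/-- There are no coboundaries in degree 0, so the projection from cycles to homology is an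
isomorphism there. -/
lemma IsClassOf.eq_zero {x : K.X 0} (h : IsClassOf K 0 x 0) : x = 0 := by
  obtain ⟨z, rfl, hz⟩ := h
  have : IsIso (K.homologyπ 0) := K.isIso_homologyπ _ 0 rfl (K.shape _ _ (by simp))
  have hinj : Function.Injective (K.homologyπ 0) :=
    (AddCommGrpCat.mono_iff_injective _).1 inferInstance
  rw [hinj (hz.trans (map_zero _).symm), map_zero]

/-! ### Connecting homomorphisms -/

variable {A B C : CochainComplex AddCommGrpCat.{u} ℕ}

/-- Degreewise short exactness of `A ⟶ B ⟶ C`, in terms of elements. -/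
structure DegreewiseExact (i : A ⟶ B) (p : B ⟶ C) : Prop where
  injective : ∀ m, Function.Injective (i.f m)
  exact : ∀ m y, p.f m y = 0 → ∃ x, i.f m x = y
  comp_zero : ∀ m x, p.f m (i.f m x) = 0
  surjective : ∀ m, Function.Surjective (p.f m)

/-- The graph of the connecting homomorphism of `A ⟶ B ⟶ C`. -/
def Connecting (i : A ⟶ B) (p : B ⟶ C) (m : ℕ) (c : C.homology m) (a : A.homology (m + 1)) :
    Prop :=
  ∃ (y : B.X m) (x : A.X (m + 1)), IsClassOf C m (p.f m y) c ∧ IsClassOf A (m + 1) x a ∧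
    i.f (m + 1) x = B.d m (m + 1) y

lemma hom_comm_apply (f : K ⟶ L) (i j : ℕ) (x : K.X i) :
    L.d i j (f.f i x) = f.f j (K.d i j x) := by
  rw [← ConcreteCategory.comp_apply, f.comm, ConcreteCategory.comp_apply]

lemma d_d_apply (i j k : ℕ) (x : K.X i) : K.d j k (K.d i j x) = 0 := by
  rw [← ConcreteCategory.comp_apply, K.d_comp_d]
  rfl

lemma Connecting.add {i : A ⟶ B} {p : B ⟶ C} {c c' : C.homology m} {a a' : A.homology (m + 1)}
    (h : Connecting i p m c a) (h' : Connecting i p m c' a') :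
    Connecting i p m (c + c') (a + a') := by
  obtain ⟨y, x, hy, hx, hxy⟩ := h
  obtain ⟨y', x', hy', hx', hxy'⟩ := h'
  refine ⟨y + y', x + x', ?_, hx.add hx', ?_⟩
  · rw [map_add]; exact hy.add hy'
  · rw [map_add, map_add, hxy, hxy']

lemma Connecting.sub {i : A ⟶ B} {p : B ⟶ C} {c c' : C.homology m} {a a' : A.homology (m + 1)}
    (h : Connecting i p m c a) (h' : Connecting i p m c' a') :
    Connecting i p m (c - c') (a - a') := by
  obtain ⟨y, x, hy, hx, hxy⟩ := h
  obtain ⟨y', x', hy', hx', hxy'⟩ := h'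
  refine ⟨y - y', x - x', ?_, hx.sub hx', ?_⟩
  · rw [map_sub]; exact hy.sub hy'
  · rw [map_sub, map_sub, hxy, hxy']

lemma Connecting.map {A' B' C' : CochainComplex AddCommGrpCat.{u} ℕ} {i : A ⟶ B} {p : B ⟶ C}
    {i' : A' ⟶ B'} {p' : B' ⟶ C'} {α : A ⟶ A'} {β : B ⟶ B'} {γ : C ⟶ C'}
    (hi : i ≫ β = α ≫ i') (hp : p ≫ γ = β ≫ p') {c : C.homology m} {a : A.homology (m + 1)}
    (h : Connecting i p m c a) :
    Connecting i' p' m (HomologicalComplex.homologyMap γ m c)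
      (HomologicalComplex.homologyMap α (m + 1) a) := by
  obtain ⟨y, x, hy, hx, hxy⟩ := h
  refine ⟨β.f m y, α.f (m + 1) x, ?_, hx.map α, ?_⟩
  · have h1 : p'.f m (β.f m y) = γ.f m (p.f m y) := by
      rw [← ConcreteCategory.comp_apply, ← ConcreteCategory.comp_apply,
        ← HomologicalComplex.comp_f, ← HomologicalComplex.comp_f, hp]
    rw [h1]
    exact hy.map γ
  · rw [hom_comm_apply, ← hxy, ← ConcreteCategory.comp_apply, ← ConcreteCategory.comp_apply,
        ← HomologicalComplex.comp_f, ← HomologicalComplex.comp_f, hi]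

/-- A class coming from `B` lifts to a cocycle of `B`, whose coboundary vanishes. -/
lemma connecting_homologyMap (i : A ⟶ B) (p : B ⟶ C) (c : B.homology m) :
    Connecting i p m (HomologicalComplex.homologyMap p m c) 0 := by
  obtain ⟨y, hy⟩ := exists_isClassOf c
  exact ⟨y, 0, hy.map p, isClassOf_zero, by rw [hy.d_eq_zero, map_zero]⟩

namespace DegreewiseExact

variable {i : A ⟶ B} {p : B ⟶ C} (h : DegreewiseExact i p)
include h

lemma exists_of_d_p_eq_zero {y : B.X m} (hy : C.d m (m + 1) (p.f m y) = 0) :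
    ∃ x a, IsClassOf A (m + 1) x a ∧ i.f (m + 1) x = B.d m (m + 1) y := by
  obtain ⟨x, hx⟩ := h.exact (m + 1) (B.d m (m + 1) y) (by rw [← hom_comm_apply, hy])
  obtain ⟨a, ha⟩ := exists_class_of_d_eq_zero (K := A) (x := x) (h.injective _ (by
    rw [← hom_comm_apply, hx, d_d_apply, map_zero]))
  exact ⟨x, a, ha, hx⟩

lemma exists_connecting (c : C.homology m) : ∃ a, Connecting i p m c a := by
  obtain ⟨z, hz⟩ := exists_isClassOf c
  obtain ⟨y, rfl⟩ := h.surjective m z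
  obtain ⟨x, a, ha, hx⟩ := h.exists_of_d_p_eq_zero (hz.d_eq_zero _)
  exact ⟨a, y, x, hz, ha, hx⟩

/-- Since the relation is compatible with subtraction, this is its single-valuedness. The lift `y`
is corrected by a coboundary of `B` until it maps to zero in `C`; it then comes from `A`, and `x` is
a coboundary there. -/
lemma eq_zero_of_connecting_zero {a : A.homology (m + 1)} (hc : Connecting i p m 0 a) :
    a = 0 := by
  obtain ⟨y, x, hy, hx, hxy⟩ := hc
  obtain ⟨y', hy', hd⟩ : ∃ y', p.f m y' = 0 ∧ B.d m (m + 1) y' = B.d m (m + 1) y := by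
    cases m with
    -- In degree 0 a cocycle of class zero is itself zero, so no correction is needed.
    | zero => exact ⟨y, hy.eq_zero, rfl⟩
    | succ m =>
      obtain ⟨z, hz⟩ := hy.exists_d_eq
      obtain ⟨t, rfl⟩ := h.surjective m z
      refine ⟨y - B.d m (m + 1) t, ?_, ?_⟩
      · rw [map_sub, ← hom_comm_apply, hz, sub_self]
      · rw [map_sub, d_d_apply, sub_zero]
  obtain ⟨x', rfl⟩ := h.exact _ _ hy'
  have : x = A.d m (m + 1) x' := h.injective _ (by rw [hxy, ← hd, hom_comm_apply])
  rw [this] at hx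
  exact hx.unique (isClassOf_d x')

lemma eq_zero_of_connecting_homologyMap {c : B.homology m} {a : A.homology (m + 1)}
    (hc : Connecting i p m (HomologicalComplex.homologyMap p m c) a) : a = 0 := by
  have := hc.sub (connecting_homologyMap i p c)
  rw [sub_self, sub_zero] at this
  exact h.eq_zero_of_connecting_zero this

/-- Exactness of the long sequence at `H^m(C)`: if `x` is the coboundary of `x'`, then `y` minus the
image of `x'` is a cocycle of `B` over the same class. -/
lemma exists_homologyMap_eq {c : C.homology m} (hc : Connecting i p m c 0) :
    ∃ b, HomologicalComplex.homologyMap p m b = c := by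
  obtain ⟨y, x, hy, hx, hxy⟩ := hc
  obtain ⟨x', rfl⟩ := hx.exists_d_eq
  obtain ⟨b, hb⟩ := exists_class_of_d_eq_zero (K := B) (x := y - i.f m x')
    (by rw [map_sub, ← hxy, hom_comm_apply, sub_self])
  have := hb.map p
  rw [map_sub, h.comp_zero, sub_zero] at this
  exact ⟨b, this.unique hy⟩

lemma exists_connecting_of_homologyMap_eq_zero {a : A.homology (m + 1)}
    (ha : HomologicalComplex.homologyMap i (m + 1) a = 0) : ∃ c, Connecting i p m c a := by
  obtain ⟨x, hx⟩ := exists_isClassOf a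
  have hix := hx.map i
  rw [ha] at hix
  obtain ⟨y, hy⟩ := hix.exists_d_eq
  obtain ⟨c, hc⟩ := exists_class_of_d_eq_zero (K := C) (x := p.f m y)
    (by rw [hom_comm_apply, hy, h.comp_zero])
  exact ⟨c, y, x, hc, hx, hy.symm⟩

end DegreewiseExact

end Complexes

section

variable {X : TopCat.{u}}

/-! ### Exactness of sections with supports -/

section Sections

variable (φ : SupportFamily X)

/-- The stalk functor at `x` on sheaves of abelian groups. -/
abbrev stalkAt (x : X) : AbSheaf X ⥤ AddCommGrpCat.{u} :=
  TopCat.Sheaf.forget AddCommGrpCat.{u} X ⋙ TopCat.Presheaf.stalkFunctor AddCommGrpCat.{u} x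

lemma stalk_map_injective {F G : AbSheaf X} (f : F ⟶ G) [Mono f] (x : X) :
    Function.Injective ((TopCat.Presheaf.stalkFunctor AddCommGrpCat.{u} x).map f.hom) :=
  (AddCommGrpCat.mono_iff_injective ((stalkAt x).map f)).1 inferInstance

lemma app_injective {F G : AbSheaf X} (f : F ⟶ G) [Mono f] (U : Opens X) :
    Function.Injective (f.hom.app (op U)) :=
  TopCat.Presheaf.app_injective_of_stalkFunctor_map_injective f.hom U
    fun x _ => stalk_map_injective f x

lemma support_subset_of_mono {F G : AbSheaf X} (f : F ⟶ G) [Mono f]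
    (s : F.presheaf.obj (op ⊤)) : support F s ⊆ support G (f.hom.app (op ⊤) s) := by
  intro x hx h
  refine hx (stalk_map_injective f x ?_)
  rw [TopCat.Presheaf.stalkFunctor_map_germ_apply, h]
  exact (map_zero _).symm

lemma Gam_map_injective {F G : AbSheaf X} (f : F ⟶ G) [Mono f] :
    Function.Injective ((Gam φ).map f) := fun _ _ h =>
  Subtype.ext (app_injective f ⊤ (congrArg Subtype.val h))

/-- Ordinary sections are left exact, and the preimage of `s` keeps its support in `φ` because a
monomorphism is injective on stalks. -/
lemma Gam_exact {S : ShortComplex (AbSheaf X)} (hS : S.Exact) [Mono S.f]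
    (s : (Gam φ).obj S.X₂) (hs : (Gam φ).map S.g s = 0) :
    ∃ t, (Gam φ).map S.f t = s := by
  obtain ⟨t, ht⟩ := TopCat.Sheaf.sections_exact_of_left_exact hS inferInstance s.1
    (congrArg Subtype.val hs)
  refine ⟨⟨t, ?_⟩, Subtype.ext ht⟩
  refine φ.mem_of_subset _ s.2 _ (isClosed_support _ _) ?_
  rw [← ht]
  exact support_subset_of_mono S.f t

end Sections

/-! ### Exactness of the canonical resolvent -/

section Canonical

variable {A B C : AbSheaf X}

instance (B : AbSheaf X) : Mono (aug B) := by
  have (U : Opens X) : Function.Injective ((aug B).hom.app (op U)) := fun s t h =>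
    TopCat.Presheaf.section_ext B U s t fun x hx => congrFun h ⟨x, hx⟩
  have (U : (Opens X)ᵒᵖ) : Mono ((aug B).hom.app U) :=
    (AddCommGrpCat.mono_iff_injective _).2 (this U.unop)
  have : Mono (aug B).hom := NatTrans.mono_of_mono_app _
  exact (TopCat.Sheaf.forget AddCommGrpCat.{u} X).mono_of_mono_map this

instance (B : AbSheaf X) : Epi (bdry B) := inferInstanceAs (Epi (cokernel.π _))

lemma aug_bdry_exact (B : AbSheaf X) : (ShortComplex.mk _ _ (aug_bdry B)).Exact :=
  ShortComplex.exact_cokernel _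

lemma Y0Map_id (B : AbSheaf X) : Y0Map (𝟙 B) = 𝟙 (Y0 B) := by
  apply CategoryTheory.Sheaf.hom_ext
  ext U s
  funext x
  exact ConcreteCategory.congr_hom
    ((TopCat.Presheaf.stalkFunctor AddCommGrpCat.{u} x.1).map_id B.presheaf) (s x)

lemma Y0Map_comp (f : A ⟶ B) (g : B ⟶ C) : Y0Map (f ≫ g) = Y0Map f ≫ Y0Map g := by
  apply CategoryTheory.Sheaf.hom_ext
  ext U s
  funext x
  exact ConcreteCategory.congr_hom
    ((TopCat.Presheaf.stalkFunctor AddCommGrpCat.{u} x.1).map_comp f.hom g.hom) (s x)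

lemma Y0Map_zero (A B : AbSheaf X) : Y0Map (0 : A ⟶ B) = 0 := by
  apply CategoryTheory.Sheaf.hom_ext
  ext U s
  funext x
  exact ConcreteCategory.congr_hom ((stalkAt x.1).map_zero A B) (s x)

lemma Z1Map_id (B : AbSheaf X) : Z1Map (𝟙 B) = 𝟙 (Z1 B) := by
  rw [← cancel_epi (bdry B), bdry_naturality, Y0Map_id, Category.comp_id]
  exact Category.id_comp _

lemma Z1Map_comp (f : A ⟶ B) (g : B ⟶ C) : Z1Map (f ≫ g) = Z1Map f ≫ Z1Map g := by
  rw [← cancel_epi (bdry A), bdry_naturality, Y0Map_comp, Category.assoc, ← bdry_naturality g,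
    ← Category.assoc, ← bdry_naturality f, Category.assoc]

lemma Z1Map_zero (A B : AbSheaf X) : Z1Map (0 : A ⟶ B) = 0 := by
  rw [← cancel_epi (bdry A), bdry_naturality, Y0Map_zero, zero_comp, comp_zero]

lemma ZmMap_id (B : AbSheaf X) : ∀ m, ZmMap (𝟙 B) m = 𝟙 (Zm B m)
  | 0 => rfl
  | m + 1 => by
    change Z1Map (ZmMap (𝟙 B) m) = 𝟙 (Z1 (Zm B m))
    rw [ZmMap_id B m, Z1Map_id]

lemma ZmMap_comp (f : A ⟶ B) (g : B ⟶ C) : ∀ m, ZmMap (f ≫ g) m = ZmMap f m ≫ ZmMap g m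
  | 0 => rfl
  | m + 1 => by
    change Z1Map (ZmMap (f ≫ g) m) = Z1Map (ZmMap f m) ≫ Z1Map (ZmMap g m)
    rw [ZmMap_comp f g m, Z1Map_comp]

lemma ZmMap_zero (A B : AbSheaf X) : ∀ m, ZmMap (0 : A ⟶ B) m = 0
  | 0 => rfl
  | m + 1 => by
    change Z1Map (ZmMap (0 : A ⟶ B) m) = 0
    rw [ZmMap_zero A B m, Z1Map_zero]

lemma YMap_id (B : AbSheaf X) : YMap (𝟙 B) = 𝟙 (Y B) := by
  ext m : 1
  change Y0Map (ZmMap (𝟙 B) m) = 𝟙 (Y0 (Zm B m))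
  rw [ZmMap_id, Y0Map_id]

lemma YMap_comp (f : A ⟶ B) (g : B ⟶ C) : YMap (f ≫ g) = YMap f ≫ YMap g := by
  ext m : 1
  change Y0Map (ZmMap (f ≫ g) m) = Y0Map (ZmMap f m) ≫ Y0Map (ZmMap g m)
  rw [ZmMap_comp, Y0Map_comp]

lemma YMap_zero (A B : AbSheaf X) : YMap (0 : A ⟶ B) = 0 := by
  ext m : 1
  change Y0Map (ZmMap (0 : A ⟶ B) m) = 0
  rw [ZmMap_zero, Y0Map_zero]

variable (φ : SupportFamily X)

lemma YphiMap_id (B : AbSheaf X) : YphiMap φ (𝟙 B) = 𝟙 (Yphi φ B) := by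
  rw [YphiMap, YMap_id]
  exact CategoryTheory.Functor.map_id _ _

lemma YphiMap_comp (f : A ⟶ B) (g : B ⟶ C) :
    YphiMap φ (f ≫ g) = YphiMap φ f ≫ YphiMap φ g := by
  rw [YphiMap, YMap_comp]
  exact CategoryTheory.Functor.map_comp _ _ _

lemma YphiMap_zero (A B : AbSheaf X) : YphiMap φ (0 : A ⟶ B) = 0 := by
  rw [YphiMap, YMap_zero]
  exact CategoryTheory.Functor.map_zero _ _ _

lemma Yphi_d (B : AbSheaf X) (m : ℕ) :
    (Yphi φ B).d m (m + 1) = (Gam φ).map (Yd B m) :=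
  congrArg (Gam φ).map (CochainComplex.of_d (Ym B) (Yd B) m)

variable {φ}

/-- The support is taken with respect to germs of `𝒴⁰`, so being outside it means that the family of
values vanishes on a whole neighbourhood, not merely at the point. -/
lemma mem_support_Y0 {B : AbSheaf X} {s : (Y0 B).presheaf.obj (op ⊤)} {x : X}
    (hx : x ∉ support (Y0 B) s) : ∃ W : Opens X, x ∈ W ∧
      ∀ y ∈ W, (s : ∀ x : (⊤ : Opens X), B.presheaf.stalk x.1) ⟨y, trivial⟩ = 0 := by
  have hx' : (Y0 B).presheaf.germ ⊤ x (Opens.mem_top x) s = 0 := by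
    simpa [support] using hx
  obtain ⟨W, hxW, i, j, h⟩ := (Y0 B).presheaf.germ_eq (C := AddCommGrpCat.{u}) x
    (Opens.mem_top x) (Opens.mem_top x) s 0 (by rw [hx', map_zero])
  exact ⟨W, hxW, fun y hy => congrFun h ⟨y, hy⟩⟩

lemma support_Y0_subset {B C : AbSheaf X} {s : (Y0 B).presheaf.obj (op ⊤)}
    {t : (Y0 C).presheaf.obj (op ⊤)}
    (h : ∀ x, (t : ∀ x : (⊤ : Opens X), C.presheaf.stalk x.1) x = 0 →
      (s : ∀ x : (⊤ : Opens X), B.presheaf.stalk x.1) x = 0) :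
    support (Y0 B) s ⊆ support (Y0 C) t := by
  intro x hx
  by_contra hxt
  obtain ⟨W, hxW, hW⟩ := mem_support_Y0 hxt
  refine hx ?_
  rw [← (Y0 B).presheaf.germ_res_apply (homOfLE (le_top : W ≤ ⊤)) x hxW s]
  have : (Y0 B).presheaf.map (homOfLE (le_top : W ≤ ⊤)).op s = 0 :=
    funext fun y => h ⟨y.1, trivial⟩ (hW y.1 y.2)
  rw [this, map_zero]

variable (φ)

lemma stalk_map_surjective (g : B ⟶ C) [Epi g] (x : X) :
    Function.Surjective ((TopCat.Presheaf.stalkFunctor AddCommGrpCat.{u} x).map g.hom) :=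
  (AddCommGrpCat.epi_iff_surjective ((stalkAt x).map g)).1 inferInstance

/-- Sections of `𝒴⁰` obey no continuity condition, so stalkwise lifts can be chosen independently at
each point. -/
lemma Gam_Y0Map_surjective (g : B ⟶ C) [Epi g] :
    Function.Surjective ((Gam φ).map (Y0Map g)) := by
  classical
  intro s
  let s' : ∀ x : (⊤ : Opens X), C.presheaf.stalk x.1 := s.1
  choose t ht using fun x : (⊤ : Opens X) => stalk_map_surjective g x.1 (s' x)
  -- Lifting zero by zero keeps the support of the lift inside that of `s`, hence in `φ`.
  let t' : ∀ x : (⊤ : Opens X), B.presheaf.stalk x.1 := fun x => if s' x = 0 then 0 else t x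
  have hsup : support (Y0 B) t' ⊆ support (Y0 C) s.1 :=
    support_Y0_subset fun x hx => if_pos hx
  refine ⟨⟨t', φ.mem_of_subset _ s.2 _ (isClosed_support _ _) hsup⟩, Subtype.ext ?_⟩
  funext x
  change (TopCat.Presheaf.stalkFunctor AddCommGrpCat.{u} x.1).map g.hom (t' x) = s' x
  by_cases hx : s' x = 0
  · rw [show t' x = 0 from if_pos hx, hx]
    exact map_zero _
  · rw [show t' x = t x from if_neg hx, ht]

variable {φ}

lemma app_Y0Map_exact {S : ShortComplex (AbSheaf X)} (hS : S.Exact) (U : Opens X)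
    (s : (Y0 S.X₂).presheaf.obj (op U)) (hs : (Y0Map S.g).hom.app (op U) s = 0) :
    ∃ t, (Y0Map S.f).hom.app (op U) t = s := by
  let s' : ∀ x : U, S.X₂.presheaf.stalk x.1 := s
  have (x : U) : ∃ t, (TopCat.Presheaf.stalkFunctor AddCommGrpCat.{u} x.1).map S.f.hom t = s' x :=
    (ShortComplex.ab_exact_iff _).1
      ((TopCat.Sheaf.exact_iff_stalkFunctor_map_exact S).1 hS x.1) (s' x) (congrFun hs x)
  choose t ht using this
  exact ⟨t, funext ht⟩

instance (f : A ⟶ B) [Mono f] : Mono (Y0Map f) := by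
  have (U : Opens X) : Function.Injective ((Y0Map f).hom.app (op U)) := fun s t h =>
    funext fun x => stalk_map_injective f x.1 (congrFun h x)
  have (U : (Opens X)ᵒᵖ) : Mono ((Y0Map f).hom.app U) :=
    (AddCommGrpCat.mono_iff_injective _).2 (this U.unop)
  have : Mono (Y0Map f).hom := NatTrans.mono_of_mono_app _
  exact (TopCat.Sheaf.forget AddCommGrpCat.{u} X).mono_of_mono_map this

instance (f : A ⟶ B) [Epi f] : Epi (Y0Map f) := by
  have (U : Opens X) : Function.Surjective ((Y0Map f).hom.app (op U)) := fun s => by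
    choose t ht using fun x : U => stalk_map_surjective f x.1
      ((s : ∀ x : U, B.presheaf.stalk x.1) x)
    exact ⟨t, funext ht⟩
  have (U : (Opens X)ᵒᵖ) : Epi ((Y0Map f).hom.app U) :=
    (AddCommGrpCat.epi_iff_surjective _).2 (this U.unop)
  have : Epi (Y0Map f).hom := NatTrans.epi_of_epi_app _
  exact (TopCat.Sheaf.forget AddCommGrpCat.{u} X).epi_of_epi_map this

/-- A complex of sheaves which is exact on sections over every open set is exact. -/
lemma exact_of_app_exact (S : ShortComplex (AbSheaf X))
    (h : ∀ (U : Opens X) (s : S.X₂.presheaf.obj (op U)), S.g.hom.app (op U) s = 0 →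
      ∃ t, S.f.hom.app (op U) t = s) : S.Exact := by
  rw [TopCat.Sheaf.exact_iff_stalkFunctor_map_exact]
  intro x
  rw [ShortComplex.ab_exact_iff]
  intro (s : S.X₂.presheaf.stalk x) hs
  obtain ⟨U, hxU, s, rfl⟩ := S.X₂.presheaf.exists_germ_eq s
  change (TopCat.Presheaf.stalkFunctor AddCommGrpCat.{u} x).map S.g.hom _ = 0 at hs
  rw [TopCat.Presheaf.stalkFunctor_map_germ_apply] at hs
  obtain ⟨W, hxW, i, j, hW⟩ := S.X₃.presheaf.germ_eq (C := AddCommGrpCat.{u}) x hxU hxU _ 0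
    (by rw [hs]; exact (map_zero _).symm)
  obtain ⟨t, ht⟩ := h W (S.X₂.presheaf.map i.op s) (by
    rw [map_zero] at hW
    rw [← hW]
    exact ConcreteCategory.congr_hom (S.g.hom.naturality i.op) s)
  refine ⟨S.X₁.presheaf.germ W x hxW t, ?_⟩
  change (TopCat.Presheaf.stalkFunctor AddCommGrpCat.{u} x).map S.f.hom _ = _
  rw [TopCat.Presheaf.stalkFunctor_map_germ_apply, ht, S.X₂.presheaf.germ_res_apply]

lemma shortExact_Y0 {f : A ⟶ B} {g : B ⟶ C} {w : f ≫ g = 0}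
    (h : (ShortComplex.mk f g w).ShortExact) :
    (ShortComplex.mk (Y0Map f) (Y0Map g)
      (by rw [← Y0Map_comp, w, Y0Map_zero])).ShortExact where
  exact := exact_of_app_exact _ fun U s hs => app_Y0Map_exact h.exact U s hs
  mono_f := by
    have := h.mono_f
    exact inferInstanceAs (Mono (Y0Map f))
  epi_g := by
    have := h.epi_g
    exact inferInstanceAs (Epi (Y0Map g))

open ZeroObject in
-- Snake lemma for the augmentations, which map one short exact row to another: their kernels
-- vanish, so their cokernels form a short exact sequence.
lemma shortExact_Z1 {f : A ⟶ B} {g : B ⟶ C} {w : f ≫ g = 0}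
    (h : (ShortComplex.mk f g w).ShortExact) :
    (ShortComplex.mk (Z1Map f) (Z1Map g)
      (by rw [← Z1Map_comp, w, Z1Map_zero])).ShortExact := by
  have hY := shortExact_Y0 h
  have h0 : IsZero (0 : AbSheaf X) := isZero_zero _
  let D : ShortComplex.SnakeInput (AbSheaf X) :=
    { L₀ := ShortComplex.mk (0 : (0 : AbSheaf X) ⟶ 0) (0 : (0 : AbSheaf X) ⟶ 0) zero_comp
      L₁ := ShortComplex.mk f g w
      L₂ := ShortComplex.mk (Y0Map f) (Y0Map g) (by rw [← Y0Map_comp, w, Y0Map_zero])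
      L₃ := ShortComplex.mk (Z1Map f) (Z1Map g) (by rw [← Z1Map_comp, w, Z1Map_zero])
      v₀₁ := 0
      v₁₂ :=
        { τ₁ := aug A
          τ₂ := aug B
          τ₃ := aug C
          comm₁₂ := (aug_naturality f).symm
          comm₂₃ := (aug_naturality g).symm }
      v₂₃ :=
        { τ₁ := bdry A
          τ₂ := bdry B
          τ₃ := bdry C
          comm₁₂ := bdry_naturality f
          comm₂₃ := bdry_naturality g }
      w₀₂ := zero_comp
      w₁₃ := by
        ext1
        · exact aug_bdry A
        · exact aug_bdry B
        · exact aug_bdry C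
      h₀ := ShortComplex.isLimitOfIsLimitπ _
        ((KernelFork.isLimitMapConeEquiv _ _).symm
          (KernelFork.IsLimit.ofMonoOfIsZero _ (inferInstance : Mono (aug A)) h0))
        ((KernelFork.isLimitMapConeEquiv _ _).symm
          (KernelFork.IsLimit.ofMonoOfIsZero _ (inferInstance : Mono (aug B)) h0))
        ((KernelFork.isLimitMapConeEquiv _ _).symm
          (KernelFork.IsLimit.ofMonoOfIsZero _ (inferInstance : Mono (aug C)) h0))
      h₃ := ShortComplex.isColimitOfIsColimitπ _
        ((CokernelCofork.isColimitMapCoconeEquiv _ _).symm (cokernelIsCokernel (aug A)))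
        ((CokernelCofork.isColimitMapCoconeEquiv _ _).symm (cokernelIsCokernel (aug B)))
        ((CokernelCofork.isColimitMapCoconeEquiv _ _).symm (cokernelIsCokernel (aug C)))
      L₁_exact := h.exact
      epi_L₁_g := h.epi_g
      L₂_exact := hY.exact
      mono_L₂_f := hY.mono_f }
  exact
    { exact := D.L₃_exact
      -- The snake sequence is exact at the first cokernel, and the connecting map into it starts
      -- from a zero kernel.
      mono_f := D.L₂'_exact.mono_g (h0.eq_of_src _ _)
      epi_g := by
        have := hY.epi_g
        have : Epi (Y0Map g ≫ bdry C) := epi_comp _ _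
        exact epi_of_epi_fac (bdry_naturality g) }

end Canonical

end

section

variable {X : TopCat.{u}} (φ : SupportFamily X)

/-! ### The long exact cohomology sequence with supports -/

section Cohomology

variable {A B C : AbSheaf X}

lemma shortExact_Zm {f : A ⟶ B} {g : B ⟶ C} {w : f ≫ g = 0}
    (h : (ShortComplex.mk f g w).ShortExact) : ∀ m,
    (ShortComplex.mk (ZmMap f m) (ZmMap g m)
      (by rw [← ZmMap_comp, w, ZmMap_zero])).ShortExact
  | 0 => h
  | m + 1 => shortExact_Z1 (shortExact_Zm h m)

lemma degreewiseExact_YphiMap {f : A ⟶ B} {g : B ⟶ C} {w : f ≫ g = 0}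
    (h : (ShortComplex.mk f g w).ShortExact) :
    DegreewiseExact (YphiMap φ f) (YphiMap φ g) where
  injective m := by
    have := (shortExact_Zm h m).mono_f
    exact Gam_map_injective φ (Y0Map (ZmMap f m))
  exact m y hy := by
    have hY := shortExact_Y0 (shortExact_Zm h m)
    have := hY.mono_f
    exact Gam_exact φ hY.exact y hy
  comp_zero m x := by
    have : YphiMap φ f ≫ YphiMap φ g = 0 := by rw [← YphiMap_comp, w, YphiMap_zero]
    exact ConcreteCategory.congr_hom (HomologicalComplex.congr_hom this m) x
  surjective m := by
    have := (shortExact_Zm h m).epi_g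
    exact Gam_Y0Map_surjective φ (ZmMap g m)

lemma HMap_id (m : ℕ) (B : AbSheaf X) (c : H φ m B) : HMap φ m (𝟙 B) c = c := by
  rw [HMap, YphiMap_id, HomologicalComplex.homologyMap_id]
  rfl

lemma HMap_comp (m : ℕ) (f : A ⟶ B) (g : B ⟶ C) (c : H φ m A) :
    HMap φ m (f ≫ g) c = HMap φ m g (HMap φ m f c) := by
  rw [HMap, YphiMap_comp, HomologicalComplex.homologyMap_comp]
  rfl

/-! ### Cohomology in degree zero -/

lemma augSection_injective (B : AbSheaf X) : Function.Injective (augSection φ B) :=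
  Gam_map_injective φ (aug B)

lemma augSection_add (s t : (Gam φ).obj B) :
    augSection φ B (s + t) = augSection φ B s + augSection φ B t :=
  map_add ((Gam φ).map (aug B)).hom s t

lemma augSection_sub (s t : (Gam φ).obj B) :
    augSection φ B (s - t) = augSection φ B s - augSection φ B t :=
  map_sub ((Gam φ).map (aug B)).hom s t

lemma augSection_zero (B : AbSheaf X) : augSection φ B 0 = 0 :=
  map_zero ((Gam φ).map (aug B)).hom

lemma YphiMap_augSection (f : A ⟶ B) (s : (Gam φ).obj A) :
    (YphiMap φ f).f 0 (augSection φ A s) = augSection φ B ((Gam φ).map f s) := by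
  change (Gam φ).map (Y0Map f) ((Gam φ).map (aug A) s) = (Gam φ).map (aug B) ((Gam φ).map f s)
  rw [← ConcreteCategory.comp_apply, ← ConcreteCategory.comp_apply, ← Functor.map_comp,
    ← Functor.map_comp, aug_naturality]

lemma d_augSection (s : (Gam φ).obj B) : (Yphi φ B).d 0 1 (augSection φ B s) = 0 := by
  rw [Yphi_d φ B 0]
  change (Gam φ).map (Yd B 0) ((Gam φ).map (aug B) s) = 0
  have h : (Gam φ).map (Yaug B 0) ≫ (Gam φ).map (Yd B 0) = 0 := by
    rw [← Functor.map_comp, Yd, ← Category.assoc, Yaug_bdry, zero_comp, Functor.map_zero]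
  exact ConcreteCategory.congr_hom h s

/-- The differential factors as `bdry` followed by a monomorphism `aug`, so a 0-cocycle is killed by
`bdry` already; left exactness of `Γ_φ` then applies. -/
lemma exists_augSection_eq {y : (Yphi φ B).X 0} (hy : (Yphi φ B).d 0 1 y = 0) :
    ∃ s, augSection φ B s = y := by
  rw [Yphi_d φ B 0] at hy
  refine Gam_exact φ (aug_bdry_exact B) y ?_
  refine Gam_map_injective φ (aug (Z1 B)) ?_
  have h : (Gam φ).map (bdry B) ≫ (Gam φ).map (aug (Z1 B)) = (Gam φ).map (Yd B 0) :=
    ((Gam φ).map_comp _ _).symm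
  exact (ConcreteCategory.congr_hom h y).trans (hy.trans (map_zero _).symm)

lemma exists_class_augSection (s : (Gam φ).obj B) :
    ∃ w, IsClassOf (Yphi φ B) 0 (augSection φ B s) w :=
  exists_class_of_d_eq_zero (d_augSection φ s)

lemma exists_augSection_class (w : H φ 0 B) :
    ∃ s, IsClassOf (Yphi φ B) 0 (augSection φ B s) w := by
  obtain ⟨y, hy⟩ := exists_isClassOf w
  obtain ⟨s, rfl⟩ := exists_augSection_eq φ (hy.d_eq_zero 1)
  exact ⟨s, hy⟩

lemma eq_zero_of_augSection_class {s : (Gam φ).obj B}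
    (h : IsClassOf (Yphi φ B) 0 (augSection φ B s) 0) : s = 0 :=
  augSection_injective φ B (h.eq_zero.trans (augSection_zero φ B).symm)

end Cohomology

/-! ### The short exact sequences of a resolvent -/

namespace Resolvent

variable (R : Resolvent X)

lemma p_ι (j : ℕ) : R.p j ≫ R.ι (j + 1) = R.L.d j (j + 1) := R.L.toCycles_i _ _

instance mono_ι : ∀ j, Mono (R.ι j)
  | 0 => R.mono_ε
  | j + 1 => inferInstanceAs (Mono (R.L.iCycles (j + 1)))

lemma ι_d : ∀ j, R.ι j ≫ R.L.d j (j + 1) = 0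
  | 0 => R.ε_d
  | _ + 1 => R.L.iCycles_d _ _

lemma ι_p (j : ℕ) : R.ι j ≫ R.p j = 0 := by
  rw [← cancel_mono (R.ι (j + 1)), Category.assoc, p_ι, ι_d, zero_comp]

lemma ι_d_exact : ∀ j, (ShortComplex.mk (R.ι j) (R.L.d j (j + 1)) (R.ι_d j)).Exact
  | 0 => R.exact_zero
  | j + 1 => ShortComplex.exact_of_f_is_kernel _ (R.L.cyclesIsKernel (j + 1) (j + 2) (by simp))

/-- The cokernel of `L^j ⟶ 𝒵^{j+1}` is the homology of `L^*` in degree `j + 1`, which vanishes for a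
resolvent. -/
lemma epi_p (j : ℕ) : Epi (R.p j) := by
  have h : R.L.ExactAt (j + 1) :=
    (R.L.exactAt_iff' j (j + 1) (j + 2) (by simp) (by simp)).2 (R.exact_succ j)
  have hex : (ShortComplex.mk (R.L.toCycles j (j + 1)) (R.L.homologyπ (j + 1))
      (R.L.toCycles_comp_homologyπ j (j + 1))).Exact :=
    ShortComplex.exact_of_g_is_cokernel _ (R.L.homologyIsCokernel j (j + 1) (by simp))
  exact hex.epi_f (h.isZero_homology.eq_of_tgt _ _)

lemma shortExact (j : ℕ) : (ShortComplex.mk (R.ι j) (R.p j) (R.ι_p j)).ShortExact where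
  exact := by
    -- Composing `p` with the monomorphism `ι (j + 1)` gives the differential and does not change
    -- the kernel, so exactness may be tested with the differential.
    let f : ShortComplex.mk (R.ι j) (R.p j) (R.ι_p j) ⟶
        ShortComplex.mk (R.ι j) (R.L.d j (j + 1)) (R.ι_d j) :=
      { τ₁ := 𝟙 _
        τ₂ := 𝟙 _
        τ₃ := R.ι (j + 1)
        comm₁₂ := (Category.id_comp _).trans (Category.comp_id _).symm
        comm₂₃ := (Category.id_comp _).trans (R.p_ι j).symm }
    have : IsIso f.τ₁ := inferInstanceAs (IsIso (𝟙 _))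
    have : IsIso f.τ₂ := inferInstanceAs (IsIso (𝟙 _))
    have : Mono f.τ₃ := R.mono_ι (j + 1)
    exact (ShortComplex.exact_iff_of_epi_of_isIso_of_mono f).2 (R.ι_d_exact j)
  mono_f := R.mono_ι j
  epi_g := R.epi_p j

lemma Gam_ι_injective (j : ℕ) : Function.Injective ((Gam φ).map (R.ι j)) :=
  Gam_map_injective φ (R.ι j)

end Resolvent

end

section

variable {X : TopCat.{u}} {φ : SupportFamily X}

/-! ### The graph of `κ` is the graph of a homomorphism -/

section Kappa

variable {R : Resolvent X} {b : ℕ} {u u' : (GamComplex φ R.L).homology b}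

lemma kappaGraph_zero_iff {w : H φ 0 (R.Z b)} :
    KappaGraph φ R b u 0 b w ↔ ∃ s : (Gam φ).obj (R.Z b),
      IsClassOf (GamComplex φ R.L) b ((Gam φ).map (R.ι b) s) u ∧
      IsClassOf (Yphi φ (R.Z b)) 0 (augSection φ (R.Z b) s) w := by
  constructor
  · intro h
    cases h with
    | start s w hu hw => exact ⟨s, hu, hw⟩
  · rintro ⟨s, hu, hw⟩
    exact KappaGraph.start s w hu hw

lemma kappaGraph_succ_iff {v j : ℕ} {w' : H φ (v + 1) (R.Z j)} :
    KappaGraph φ R b u (v + 1) j w' ↔ ∃ w, KappaGraph φ R b u v (j + 1) w ∧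
      Connecting (YphiMap φ (R.ι j)) (YphiMap φ (R.p j)) v w w' := by
  constructor
  · intro h
    cases h with
    | step v j w w' h hδ => exact ⟨w, h, hδ⟩
  · rintro ⟨w, h, hδ⟩
    exact KappaGraph.step v j w w' h hδ

lemma KappaGraph.add_eq {v j : ℕ} {w : H φ v (R.Z j)} (h : KappaGraph φ R b u v j w) :
    v + j = b := by
  induction h with
  | start => omega
  | step => omega

lemma degreewiseExact_resolvent (φ : SupportFamily X) (R : Resolvent X) (j : ℕ) :
    DegreewiseExact (YphiMap φ (R.ι j)) (YphiMap φ (R.p j)) :=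
  degreewiseExact_YphiMap φ (R.shortExact j)

lemma exists_section_of_class (u : (GamComplex φ R.L).homology b) :
    ∃ s : (Gam φ).obj (R.Z b),
      IsClassOf (GamComplex φ R.L) b ((Gam φ).map (R.ι b) s) u := by
  obtain ⟨x, hx⟩ := exists_isClassOf u
  obtain ⟨s, rfl⟩ := Gam_exact φ (R.ι_d_exact b) x (hx.d_eq_zero (b + 1))
  exact ⟨s, hx⟩

lemma exists_class_of_section (s : (Gam φ).obj (R.Z b)) :
    ∃ u, IsClassOf (GamComplex φ R.L) b ((Gam φ).map (R.ι b) s) u := by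
  refine exists_class_of_d_eq_zero ?_
  change (Gam φ).map (R.L.d b (b + 1)) _ = 0
  rw [← ConcreteCategory.comp_apply, ← Functor.map_comp, R.ι_d, Functor.map_zero]
  rfl

lemma exists_kappaGraph (u : (GamComplex φ R.L).homology b) :
    ∀ v j, v + j = b → ∃ w, KappaGraph φ R b u v j w := by
  intro v
  induction v with
  | zero =>
    rintro j hj
    obtain rfl : j = b := by omega
    obtain ⟨s, hs⟩ := exists_section_of_class u
    obtain ⟨w, hw⟩ := exists_class_augSection φ s
    exact ⟨w, KappaGraph.start s w hs hw⟩
  | succ v ih =>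
    intro j hj
    obtain ⟨w, hw⟩ := ih (j + 1) (by omega)
    obtain ⟨w', hw'⟩ := (degreewiseExact_resolvent φ R j).exists_connecting w
    exact ⟨w', kappaGraph_succ_iff.2 ⟨w, hw, hw'⟩⟩

lemma KappaGraph.add {v j : ℕ} {w w' : H φ v (R.Z j)} (h : KappaGraph φ R b u v j w)
    (h' : KappaGraph φ R b u' v j w') : KappaGraph φ R b (u + u') v j (w + w') := by
  induction v generalizing j with
  | zero =>
    obtain rfl : j = b := by have := h.add_eq; omega
    obtain ⟨s, hs, hw⟩ := kappaGraph_zero_iff.1 h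
    obtain ⟨s', hs', hw'⟩ := kappaGraph_zero_iff.1 h'
    refine kappaGraph_zero_iff.2 ⟨s + s', ?_, ?_⟩
    · rw [map_add]; exact hs.add hs'
    · rw [augSection_add]; exact hw.add hw'
  | succ v ih =>
    obtain ⟨t, ht, hδ⟩ := kappaGraph_succ_iff.1 h
    obtain ⟨t', ht', hδ'⟩ := kappaGraph_succ_iff.1 h'
    exact kappaGraph_succ_iff.2 ⟨t + t', ih ht ht', hδ.add hδ'⟩

lemma KappaGraph.sub {v j : ℕ} {w w' : H φ v (R.Z j)} (h : KappaGraph φ R b u v j w)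
    (h' : KappaGraph φ R b u' v j w') : KappaGraph φ R b (u - u') v j (w - w') := by
  induction v generalizing j with
  | zero =>
    obtain rfl : j = b := by have := h.add_eq; omega
    obtain ⟨s, hs, hw⟩ := kappaGraph_zero_iff.1 h
    obtain ⟨s', hs', hw'⟩ := kappaGraph_zero_iff.1 h'
    refine kappaGraph_zero_iff.2 ⟨s - s', ?_, ?_⟩
    · rw [map_sub]; exact hs.sub hs'
    · rw [augSection_sub]; exact hw.sub hw'
  | succ v ih =>
    obtain ⟨t, ht, hδ⟩ := kappaGraph_succ_iff.1 h
    obtain ⟨t', ht', hδ'⟩ := kappaGraph_succ_iff.1 h'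
    exact kappaGraph_succ_iff.2 ⟨t - t', ih ht ht', hδ.sub hδ'⟩

/-- Single-valuedness of the relation. The condition `hv` is essential: for `b > 0` the section of
`𝒵^b` representing a class is not unique, and this ambiguity only disappears after the first
connecting homomorphism. -/
lemma KappaGraph.eq_zero {v j : ℕ} {w : H φ v (R.Z j)} (h : KappaGraph φ R b 0 v j w)
    (hv : v = 0 → b = 0) : w = 0 := by
  induction v generalizing j with
  | zero =>
    obtain rfl : j = b := by have := h.add_eq; omega
    obtain rfl := hv rfl
    obtain ⟨s, hs, hw⟩ := kappaGraph_zero_iff.1 h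
    have hs0 : s = 0 := R.Gam_ι_injective φ 0 (hs.eq_zero.trans (map_zero _).symm)
    rw [hs0, augSection_zero] at hw
    exact hw.unique isClassOf_zero
  | succ v ih =>
    obtain ⟨t, ht, hδ⟩ := kappaGraph_succ_iff.1 h
    cases v with
    | zero =>
      obtain rfl : j + 1 = b := by have := h.add_eq; omega
      obtain ⟨s, hs, hw⟩ := kappaGraph_zero_iff.1 ht
      -- As `s` represents the zero class, its image in `L^{j+1}` is a coboundary, so `s` is the
      -- image of a section `y` of `L^j`. The class `t` then comes from `H^0_φ(X; L^j)`, which the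
      -- connecting homomorphism kills.
      obtain ⟨y, hy⟩ : ∃ y : (Gam φ).obj (R.L.X j),
          (Gam φ).map (R.L.d j (j + 1)) y = (Gam φ).map (R.ι (j + 1)) s := hs.exists_d_eq
      obtain rfl : (Gam φ).map (R.p j) y = s := by
        refine R.Gam_ι_injective φ (j + 1) ?_
        rw [← ConcreteCategory.comp_apply, ← Functor.map_comp, R.p_ι]
        exact hy
      obtain ⟨c, hc⟩ := exists_class_augSection φ y
      have hpc := hc.map (YphiMap φ (R.p j))
      rw [YphiMap_augSection] at hpc
      obtain rfl := hpc.unique hw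
      exact (degreewiseExact_resolvent φ R j).eq_zero_of_connecting_homologyMap hδ
    | succ v =>
      obtain rfl := ih ht (by omega)
      exact (degreewiseExact_resolvent φ R j).eq_zero_of_connecting_zero hδ

variable (φ R b) in
/-- The homomorphism `κ : H^b(Γ_φ(L^*)) → H^b_φ(X; B)` of a resolvent. -/
def kappa : (GamComplex φ R.L).homology b →+ H φ b R.B :=
  AddMonoidHom.mk' (fun u => (exists_kappaGraph u b 0 (add_zero b)).choose) fun u u' => by
    have h := (exists_kappaGraph (u + u') b 0 (add_zero b)).choose_spec.sub
      ((exists_kappaGraph u b 0 (add_zero b)).choose_spec.add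
        (exists_kappaGraph u' b 0 (add_zero b)).choose_spec)
    rw [sub_self] at h
    -- Only end values `v = b` occur here, so the side condition reads `b = 0 → b = 0`.
    exact sub_eq_zero.1 (h.eq_zero id)

lemma kappaGraph_kappa (u : (GamComplex φ R.L).homology b) :
    KappaGraph φ R b u b 0 (kappa φ R b u) :=
  (exists_kappaGraph u b 0 (add_zero b)).choose_spec

lemma KappaGraph.kappa_eq {w : H φ b R.B} (h : KappaGraph φ R b u b 0 w) :
    kappa φ R b u = w := by
  have h' := (kappaGraph_kappa u).sub h
  rw [sub_self] at h'
  exact sub_eq_zero.1 (h'.eq_zero id)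

lemma isKappa_kappa : IsKappa φ R b (kappa φ R b) := fun u _ =>
  ⟨fun h => h ▸ kappaGraph_kappa u, KappaGraph.kappa_eq⟩

/-! ### `κ` is an isomorphism for acyclic resolvents -/

/-- Injectivity, by going back along the chain: the class before each connecting homomorphism comes
from `H^v_φ(X; L^j)`, which is zero for `v > 0`. -/
lemma KappaGraph.eq_zero_of_isAcyclic (hR : ∀ m, IsAcyclic φ (R.L.X m)) {v j : ℕ}
    (h : KappaGraph φ R b u v j 0) : u = 0 := by
  induction v generalizing j with
  | zero =>
    obtain rfl : j = b := by have := h.add_eq; omega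
    obtain ⟨s, hs, hw⟩ := kappaGraph_zero_iff.1 h
    rw [eq_zero_of_augSection_class φ hw, map_zero] at hs
    exact hs.unique isClassOf_zero
  | succ v ih =>
    obtain ⟨t, ht, hδ⟩ := kappaGraph_succ_iff.1 h
    obtain ⟨c, rfl⟩ := (degreewiseExact_resolvent φ R j).exists_homologyMap_eq hδ
    cases v with
    -- Here `H^0_φ(X; L^j)` need not vanish. Its class `c` is given by a section `y` with `s = p y`,
    -- so the cocycle representing `u` is the coboundary of `y`.
    | zero =>
      obtain rfl : j + 1 = b := by have := h.add_eq; omega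
      obtain ⟨s, hs, hw⟩ := kappaGraph_zero_iff.1 ht
      obtain ⟨y, hy⟩ := exists_augSection_class φ c
      have hpy := hy.map (YphiMap φ (R.p j))
      rw [YphiMap_augSection] at hpy
      have hsub := hw.sub hpy
      rw [sub_self, ← augSection_sub] at hsub
      obtain rfl := sub_eq_zero.1 (eq_zero_of_augSection_class φ hsub)
      rw [← ConcreteCategory.comp_apply, ← Functor.map_comp, R.p_ι] at hs
      exact hs.unique (isClassOf_d (K := GamComplex φ R.L) y)
    | succ v =>
      obtain rfl := hR j (v + 1) (Nat.succ_pos v) c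
      rw [map_zero] at ht
      exact ih ht

/-- Surjectivity: for `v > 0` the image of `w` in `H^v_φ(X; L^j)` is zero by acyclicity, so `w` is
hit by the preceding connecting homomorphism; in degree 0 every class is a section of `𝒵^b`. -/
lemma exists_kappaGraph_of_isAcyclic (hR : ∀ m, IsAcyclic φ (R.L.X m)) :
    ∀ v j (w : H φ v (R.Z j)), v + j = b → ∃ u, KappaGraph φ R b u v j w := by
  intro v
  induction v with
  | zero =>
    intro j w hj
    obtain rfl : j = b := by omega
    obtain ⟨s, hs⟩ := exists_augSection_class φ w
    obtain ⟨u, hu⟩ := exists_class_of_section s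
    exact ⟨u, KappaGraph.start s w hu hs⟩
  | succ v ih =>
    intro j w hj
    obtain ⟨c, hc⟩ := (degreewiseExact_resolvent φ R j).exists_connecting_of_homologyMap_eq_zero
      (a := w) (hR j (v + 1) (Nat.succ_pos v) _)
    obtain ⟨u, hu⟩ := ih (j + 1) c (by omega)
    exact ⟨u, kappaGraph_succ_iff.2 ⟨c, hu, hc⟩⟩

lemma kappa_bijective (hR : ∀ m, IsAcyclic φ (R.L.X m)) :
    Function.Bijective (kappa φ R b) := by
  constructor
  · refine (injective_iff_map_eq_zero _).2 fun u hu => ?_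
    have h := kappaGraph_kappa u
    rw [hu] at h
    exact KappaGraph.eq_zero_of_isAcyclic hR h
  · intro w
    obtain ⟨u, hu⟩ := exists_kappaGraph_of_isAcyclic hR b 0 w (add_zero b)
    exact ⟨u, hu.kappa_eq⟩

end Kappa

/-! ### Naturality of `κ` -/

namespace ResolventHom

variable {R S : Resolvent X} (h : ResolventHom R S)

/-- The map `𝒵^j(L) ⟶ 𝒵^j(M)` induced by a homomorphism of resolvents. -/
def ZMap : ∀ j, R.Z j ⟶ S.Z j
  | 0 => h.f
  | j + 1 => HomologicalComplex.cyclesMap h.g (j + 1)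

lemma ι_ZMap : ∀ j, R.ι j ≫ h.g.f j = h.ZMap j ≫ S.ι j
  | 0 => h.comm
  | j + 1 => (HomologicalComplex.cyclesMap_i h.g (j + 1)).symm

lemma p_ZMap (j : ℕ) : R.p j ≫ h.ZMap (j + 1) = h.g.f j ≫ S.p j := by
  rw [← cancel_mono (S.ι (j + 1)), Category.assoc, ← ι_ZMap, Category.assoc, S.p_ι,
    ← Category.assoc, R.p_ι, h.g.comm]

/-- A homomorphism of resolvents maps the sequences `0 ⟶ 𝒵^j ⟶ L^j ⟶ 𝒵^{j+1} ⟶ 0` to each other, so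
each link of the chain is carried along. -/
lemma kappaGraph_map {b : ℕ} {u : (GamComplex φ R.L).homology b} {v j : ℕ}
    {w : H φ v (R.Z j)} (hw : KappaGraph φ R b u v j w) :
    KappaGraph φ S b (HomologicalComplex.homologyMap (GamComplexMap φ h.g) b u) v j
      (HMap φ v (h.ZMap j) w) := by
  induction v generalizing j with
  | zero =>
    obtain rfl : j = b := by have := hw.add_eq; omega
    obtain ⟨s, hs, hws⟩ := kappaGraph_zero_iff.1 hw
    refine kappaGraph_zero_iff.2 ⟨(Gam φ).map (h.ZMap j) s, ?_, ?_⟩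
    · have e : (Gam φ).map (h.g.f j) ((Gam φ).map (R.ι j) s) =
          (Gam φ).map (S.ι j) ((Gam φ).map (h.ZMap j) s) := by
        rw [← ConcreteCategory.comp_apply, ← Functor.map_comp, h.ι_ZMap, Functor.map_comp,
          ConcreteCategory.comp_apply]
      rw [← e]
      exact hs.map (GamComplexMap φ h.g)
    · have := hws.map (YphiMap φ (h.ZMap j))
      rwa [YphiMap_augSection] at this
  | succ v ih =>
    obtain ⟨t, ht, hδ⟩ := kappaGraph_succ_iff.1 hw
    refine kappaGraph_succ_iff.2 ⟨_, ih ht, hδ.map (β := YphiMap φ (h.g.f j)) ?_ ?_⟩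
    · rw [← YphiMap_comp, ← YphiMap_comp, h.ι_ZMap]
    · rw [← YphiMap_comp, ← YphiMap_comp, h.p_ZMap]

lemma kappa_map {b : ℕ} (c : (GamComplex φ R.L).homology b) :
    kappa φ S b (HomologicalComplex.homologyMap (GamComplexMap φ h.g) b c) =
      HMap φ b h.f (kappa φ R b c) :=
  (h.kappaGraph_map (kappaGraph_kappa c)).kappa_eq

end ResolventHom

end

section

variable {X : TopCat.{u}} {φ : SupportFamily X}

/-! ### Retracts -/

/-- The identity of the homology of `S` factors through that of `T`, which is zero. -/
lemma exact_of_retract {S T : ShortComplex (AbSheaf X)} (i : S ⟶ T) (p : T ⟶ S)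
    (h : i ≫ p = 𝟙 S) (hT : T.Exact) : S.Exact := by
  rw [ShortComplex.exact_iff_isZero_homology] at hT ⊢
  rw [IsZero.iff_id_eq_zero, ← ShortComplex.homologyMap_id, ← h, ShortComplex.homologyMap_comp,
    hT.eq_of_tgt (ShortComplex.homologyMap i) 0, zero_comp]

lemma IsAcyclic.of_retract {F G : AbSheaf X} (i : G ⟶ F) (p : F ⟶ G) (h : i ≫ p = 𝟙 G)
    (hF : IsAcyclic φ F) : IsAcyclic φ G := by
  intro m hm c
  rw [← HMap_id φ m G c, ← h, HMap_comp, hF m hm (HMap φ m i c), map_zero]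

/-! ### Components of twisted sheaves and resolvents -/

namespace TwistedStructure

variable {r : ℕ} {F G : AbSheaf X} (S : TwistedStructure r F) (T : TwistedStructure r G)

/-- The projection of a twisted sheaf to its `k`-th component. -/
def proj (k : Fin (2 ^ r)) : F ⟶ S.comp k :=
  S.isSum.some.desc (Cofan.mk _ fun j =>
    if h : j = k then eqToHom (congrArg S.comp h) else 0)

lemma incl_proj (j k : Fin (2 ^ r)) :
    S.incl j ≫ S.proj k = if h : j = k then eqToHom (congrArg S.comp h) else 0 :=
  S.isSum.some.fac _ ⟨j⟩

lemma incl_proj_self (k : Fin (2 ^ r)) : S.incl k ≫ S.proj k = 𝟙 _ := by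
  rw [incl_proj, dif_pos rfl, eqToHom_refl]

lemma incl_proj_of_ne {j k : Fin (2 ^ r)} (h : j ≠ k) : S.incl j ≫ S.proj k = 0 := by
  rw [incl_proj, dif_neg h]

instance mono_incl (k : Fin (2 ^ r)) : Mono (S.incl k) :=
  mono_of_mono_fac (S.incl_proj_self k)

lemma hom_ext {H : AbSheaf X} {f g : F ⟶ H} (h : ∀ k, S.incl k ≫ f = S.incl k ≫ g) : f = g :=
  S.isSum.some.hom_ext fun k => h k.as

variable {S T} {f : F ⟶ G}

/-- The map of `k`-th components induced by a homomorphism that preserves components. -/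
def Preserves.compMap (h : S.Preserves T f) (k : Fin (2 ^ r)) : S.comp k ⟶ T.comp k :=
  (h k).choose

lemma Preserves.incl_comm (h : S.Preserves T f) (k : Fin (2 ^ r)) :
    S.incl k ≫ f = h.compMap k ≫ T.incl k :=
  (h k).choose_spec

/-- Compatibility with inclusions forces compatibility with projections, checked on each summand:
off the `k`-th one both sides vanish. -/
lemma Preserves.proj_comm (h : S.Preserves T f) (k : Fin (2 ^ r)) :
    S.proj k ≫ h.compMap k = f ≫ T.proj k := by
  refine S.hom_ext fun j => ?_
  by_cases hj : j = k
  · subst hj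
    calc S.incl j ≫ S.proj j ≫ h.compMap j
      _ = h.compMap j := by rw [← Category.assoc, incl_proj_self, Category.id_comp]
      _ = h.compMap j ≫ T.incl j ≫ T.proj j := by rw [incl_proj_self, Category.comp_id]
      _ = S.incl j ≫ f ≫ T.proj j := by rw [← Category.assoc, ← h.incl_comm, Category.assoc]
  · calc S.incl j ≫ S.proj k ≫ h.compMap k
      _ = 0 := by rw [← Category.assoc, S.incl_proj_of_ne hj, zero_comp]
      _ = h.compMap j ≫ T.incl j ≫ T.proj k := by rw [T.incl_proj_of_ne hj, comp_zero]
      _ = S.incl j ≫ f ≫ T.proj k := by rw [← Category.assoc, ← h.incl_comm, Category.assoc]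

end TwistedStructure

namespace TwistedResolvent

variable {r : ℕ} {R : Resolvent X} (T : TwistedResolvent r R) (k : Fin (2 ^ r))

/-- The complex formed by the `k`-th components of a twisted resolvent. -/
def componentL : CochainComplex (AbSheaf X) ℕ :=
  CochainComplex.of (fun m => (T.onL m).comp k) (fun m => (T.preserves_d m).compMap k) fun m => by
    rw [← cancel_mono ((T.onL (m + 1 + 1)).incl k), Category.assoc,
      ← (T.preserves_d (m + 1)).incl_comm, ← Category.assoc, ← (T.preserves_d m).incl_comm,
      Category.assoc, R.L.d_comp_d, comp_zero, zero_comp]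

lemma componentL_d (m : ℕ) : (T.componentL k).d m (m + 1) = (T.preserves_d m).compMap k :=
  CochainComplex.of_d (fun m => (T.onL m).comp k) (fun m => (T.preserves_d m).compMap k) m

/-- The inclusion of the complex of `k`-th components. -/
def inclL : T.componentL k ⟶ R.L :=
  CochainComplex.ofHom (fun m => (T.onL m).incl k) fun m => by
    rw [componentL_d]
    exact (T.preserves_d m).incl_comm k

/-- The projection to the complex of `k`-th components. -/
def projL : R.L ⟶ T.componentL k :=
  CochainComplex.ofHom (fun m => (T.onL m).proj k) fun m => by
    rw [componentL_d]
    exact (T.preserves_d m).proj_comm k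

lemma inclL_projL : T.inclL k ≫ T.projL k = 𝟙 _ := by
  ext m : 1
  exact (T.onL m).incl_proj_self k

/-- The augmentation of the complex of `k`-th components. -/
def componentε : T.onB.comp k ⟶ (T.componentL k).X 0 := T.preserves_ε.compMap k

lemma componentε_inclL : T.componentε k ≫ (T.inclL k).f 0 = T.onB.incl k ≫ R.ε :=
  (T.preserves_ε.incl_comm k).symm

lemma proj_componentε : T.onB.proj k ≫ T.componentε k = R.ε ≫ (T.projL k).f 0 :=
  T.preserves_ε.proj_comm k

lemma componentε_d : T.componentε k ≫ (T.componentL k).d 0 1 = 0 := by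
  have : Mono ((T.inclL k).f 1) := (T.onL 1).mono_incl k
  rw [← cancel_mono ((T.inclL k).f 1), Category.assoc, ← (T.inclL k).comm, ← Category.assoc,
    componentε_inclL, Category.assoc, R.ε_d, comp_zero, zero_comp]

/-- The resolvent formed by the `k`-th components of a twisted resolvent. -/
def component : Resolvent X where
  B := T.onB.comp k
  L := T.componentL k
  ε := T.componentε k
  ε_d := T.componentε_d k
  mono_ε := by
    have := R.mono_ε
    have : Mono (T.onB.incl k ≫ R.ε) := mono_comp _ _
    exact mono_of_mono_fac (T.componentε_inclL k)
  exact_zero := by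
    -- Inclusion and projection exhibit the component sequence as a retract of that of `R`, from
    -- which it inherits exactness.
    refine exact_of_retract (T := ShortComplex.mk R.ε (R.L.d 0 1) R.ε_d)
      { τ₁ := T.onB.incl k
        τ₂ := (T.inclL k).f 0
        τ₃ := (T.inclL k).f 1
        comm₁₂ := (T.componentε_inclL k).symm
        comm₂₃ := (T.inclL k).comm 0 1 }
      { τ₁ := T.onB.proj k
        τ₂ := (T.projL k).f 0
        τ₃ := (T.projL k).f 1
        comm₁₂ := T.proj_componentε k
        comm₂₃ := (T.projL k).comm 0 1 } ?_ R.exact_zero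
    ext1
    · exact T.onB.incl_proj_self k
    · exact (T.onL 0).incl_proj_self k
    · exact (T.onL 1).incl_proj_self k
  exact_succ m := by
    let F := HomologicalComplex.shortComplexFunctor' (AbSheaf X) (ComplexShape.up ℕ)
      m (m + 1) (m + 2)
    refine exact_of_retract (F.map (T.inclL k)) (F.map (T.projL k)) ?_ (R.exact_succ m)
    rw [← F.map_comp, inclL_projL, F.map_id]

/-- The inclusion of the resolvent of `k`-th components. -/
def componentHom : ResolventHom (T.component k) R where
  f := T.onB.incl k
  g := T.inclL k
  comm := T.componentε_inclL k

lemma component_isAcyclic (hR : ∀ m, IsAcyclic φ (R.L.X m)) (m : ℕ) :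
    IsAcyclic φ ((T.component k).L.X m) :=
  (hR m).of_retract ((T.onL m).incl k) ((T.onL m).proj k) ((T.onL m).incl_proj_self k)

/-- A section of the component that becomes a cocycle in `L^b` is already a cocycle of the component
complex, because the inclusion in degree `b + 1` is injective on sections. -/
lemma sourceComponent_eq (φ : SupportFamily X) (b : ℕ) :
    T.sourceComponent φ b k = Set.range
      (HomologicalComplex.homologyMap (GamComplexMap φ (T.componentHom k).g) b) := by
  ext u
  constructor
  · rintro ⟨x, hx⟩
    have hd : (GamComplex φ (T.componentL k)).d b (b + 1) x = 0 := by
      have := (T.onL (b + 1)).mono_incl k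
      refine Gam_map_injective φ ((T.onL (b + 1)).incl k) ?_
      exact (hom_comm_apply (GamComplexMap φ (T.inclL k)) b (b + 1) x).symm.trans
        ((hx.d_eq_zero (b + 1)).trans (map_zero _).symm)
    obtain ⟨c, hc⟩ := exists_class_of_d_eq_zero hd
    exact ⟨c, (hc.map (GamComplexMap φ (T.inclL k))).unique hx⟩
  · rintro ⟨c, rfl⟩
    obtain ⟨x, hx⟩ := exists_isClassOf c
    exact ⟨x, hx.map (GamComplexMap φ (T.inclL k))⟩

/-- Naturality for `componentHom` gives one inclusion. The other also needs `κ` of the component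
resolvent to be surjective, which is where acyclicity enters. -/
lemma kappa_image_sourceComponent (hR : ∀ m, IsAcyclic φ (R.L.X m)) (b : ℕ) :
    kappa φ R b '' T.sourceComponent φ b k = T.targetComponent φ b k := by
  rw [sourceComponent_eq]
  ext w
  constructor
  · rintro ⟨_, ⟨c, rfl⟩, rfl⟩
    exact ⟨kappa φ (T.component k) b c, ((T.componentHom k).kappa_map c).symm⟩
  · rintro ⟨w, rfl⟩
    obtain ⟨c, rfl⟩ := (kappa_bijective (T.component_isAcyclic k hR)).2 w
    exact ⟨_, ⟨c, rfl⟩, (T.componentHom k).kappa_map c⟩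

end TwistedResolvent

end

end SupportCohomology

end

theorem theorem48p1 {X : TopCat.{u}} (φ : SupportCohomology.SupportFamily X) (b : ℕ) :
    ∃ κ : ∀ R : SupportCohomology.Resolvent X,
        (SupportCohomology.GamComplex φ R.L).homology b →+ SupportCohomology.H φ b R.B,
      -- `κ` is the iterated connecting homomorphism
      (∀ R : SupportCohomology.Resolvent X, SupportCohomology.IsKappa φ R b (κ R)) ∧
      -- `κ` is natural with respect to homomorphisms of resolvents
      (∀ (R S : SupportCohomology.Resolvent X) (h : SupportCohomology.ResolventHom R S)
        (c : (SupportCohomology.GamComplex φ R.L).homology b),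
        κ S (HomologicalComplex.homologyMap (SupportCohomology.GamComplexMap φ h.g) b c) =
          SupportCohomology.HMap φ b h.f (κ R c)) ∧
      -- `κ` is an isomorphism when all `L^m` are `φ`-acyclic
      (∀ R : SupportCohomology.Resolvent X,
        (∀ m : ℕ, SupportCohomology.IsAcyclic φ (R.L.X m)) → Function.Bijective (κ R)) ∧
      -- in the twisted case this isomorphism matches the components
      (∀ (R : SupportCohomology.Resolvent X) (r : ℕ)
        (T : SupportCohomology.TwistedResolvent r R),
        (∀ m : ℕ, SupportCohomology.IsAcyclic φ (R.L.X m)) →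
        ∀ k : Fin (2 ^ r), κ R '' T.sourceComponent φ b k = T.targetComponent φ b k) := by
  exact ⟨fun R => SupportCohomology.kappa φ R b, fun _ => SupportCohomology.isKappa_kappa,
    fun _ _ h => h.kappa_map, fun _ => SupportCohomology.kappa_bijective,
    fun _ _ T hR k => T.kappa_image_sourceComponent k hR b⟩
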